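/- **(Local truncation error of the explicit and implicit SDG schemes.)** Let $p,K\ge 0$ be integers, $T>0$, let $f:\mathbb R\times\mathbb R\to\mathbb R$ be of class $C^{2p+1}$, and let $u$ be the exact solution on $[0,T]$ of $u'(t)=f(t,u(t))$, $u(0)=u_0$. Let $-1<x_0<\dots<x_p=1$ and $\omega_0,\dots,\omega_p$ be the nodes and weights of the right Gauss–Radau rule on $[-1,1]$ (the $(p+1)$-point rule with the right endpoint as a node that is exact for polynomials of degree $\le 2p$), let $\ell_0,\dots,\ell_p$ be the Lagrange polynomials of these nodes, put $$L_{ij}=\int_{-1}^{1}\ell_i'\,\ell_j\,dt-\delta_{ip}\delta_{jp}\qquad(0\le i,j\le p),$$ and let $\tilde L=(\tilde l_{ij})$ have the entries $\tilde l_{0j}=-(L^{-1})_{0j}$ and $\tilde l_{m+1,j}=(L^{-1})_{mj}-(L^{-1})_{m+1,j}$ for $0\le m\le p-1$. For a partition $0=t_0<t_1<\dots<t_N=T$ put $\Delta t_n=t_{n+1}-t_n$, $h=\max_n\Delta t_n$ and $t_{n,m}=t_n+\frac{\Delta t_n}{2}(x_m+1)$, so that $t_{n,p}=t_{n+1}$.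 Write $U^k=(u^k_{n,0},\dots,u^k_{n,p})$ and $f^k_{m}=f(t_{n,m},u^k_{n,m})$, and start each step from the exact value $u_n=u(t_n)$. The explicit SDG scheme is $$u^{k+1}_{n,0}=u_n+\tfrac{\Delta t_n}{2}\sum_{j=0}^p\tilde l_{0j}\omega_jf^k_j,\qquad u^{k+1}_{n,m+1}=u^{k+1}_{n,m}+\tfrac{\Delta t_n}{2}\omega_m\bigl(f^{k+1}_m-f^k_m\bigr)+\tfrac{\Delta t_n}{2}\sum_{j=0}^p\tilde l_{m+1,j}\omega_jf^k_j,$$ and the implicit SDG scheme is $$u^{k+1}_{n,0}=u_n+\tfrac{\Delta t_n}{2}\omega_0\bigl(f^{k+1}_0-f^k_0\bigr)+\tfrac{\Delta t_n}{2}\sum_{j=0}^p\tilde l_{0j}\omega_jf^k_j,$$ $$u^{k+1}_{n,m+1}=u^{k+1}_{n,m}+\tfrac{\Delta t_n}{2}\omega_{m+1}\bigl(f^{k+1}_{m+1}-f^k_{m+1}\bigr)+\tfrac{\Delta t_n}{2}\sum_{j=0}^p\tilde l_{m+1,j}\omega_jf^k_j,$$ with $0\le m\le p-1$ in both. The starting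 vector $U^0$ is obtained by marching from $(t_n,u_n)$ through the nodes $t_{n,0},\dots,t_{n,p}$ with the Euler method (explicit Euler for the explicit scheme, implicit Euler for the implicit one), or it is any vector with $|u(t_{n,m})-u^0_{n,m}|\le C_0h^2$ for all $m$, where $C_0$ is a given constant. Since the implicit equations may have further, spurious solutions far away, their solutions are those within a given distance $R>0$ of the exact solution at the nodes: $|u(t_{n,m})-u^k_{n,m}|\le R$ for $0\le k\le K$ and all $m$. Then for every $C_0$ (and every $R>0$ in the implicit case) there are constants $C$ and $h_0>0$ such that, for every partition with $h\le h_0$ and every $n$, in the implicit case the implicit Euler vector and, for each admissible $U^0$, the iterates $U^0,\dots,U^K$ exist and are unique within distance $R$ of the exact solution, and in both cases the $K$-th iterate satisfies $$|u(t_{n,m})-u^K_{n,m}|\le C\,h^{\min\{p+2,\,K+2\}}\quad(0\le m\le p-1),\qquad |u(t_{n+1})-u^K_{n,p}|\le C\,h^{\min\{2p+2,\,K+2\}}.$$ -/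

import Mathlib

open Polynomial

noncomputable section

namespace SDG

/-- `x` and `ω` are the nodes and the weights of the right Gauss-Radau quadrature rule with `p + 1`
points on the reference interval `[-1, 1]`: the right endpoint is the last node, the left endpoint is
not a node, and the rule is exact for all polynomials of degree at most `2 p`. -/
structure IsRightGaussRadau (p : ℕ) (x ω : Fin (p + 1) → ℝ) : Prop where
  strictMono : StrictMono x
  left_lt : -1 < x 0
  last_eq : x (Fin.last p) = 1
  exact : ∀ q : ℝ[X], q.natDegree ≤ 2 * p →
    ∑ m, ω m * q.eval (x m) = ∫ s in (-1 : ℝ)..1, q.eval s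

/-- The Lagrange polynomial of degree `p` attached to the node `x i`. -/
def ell {p : ℕ} (x : Fin (p + 1) → ℝ) (i : Fin (p + 1)) : ℝ[X] :=
  Lagrange.basis Finset.univ x i

/-- The matrix `L i j = ∫_{-1}^{1} ℓ i' ℓ j - δ_{i p} δ_{j p}` of the nodal discontinuous Galerkin
weak form on the reference interval. -/
def dgMatrix {p : ℕ} (x : Fin (p + 1) → ℝ) : Matrix (Fin (p + 1)) (Fin (p + 1)) ℝ :=
  Matrix.of fun i j =>
    (∫ s in (-1 : ℝ)..1, (derivative (ell x i)).eval s * (ell x j).eval s)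
      - if i = Fin.last p ∧ j = Fin.last p then 1 else 0

/-- The matrix `L̃`: its first row is minus the first row of `L⁻¹`, and its row `m + 1` is the row `m`
of `L⁻¹` minus the row `m + 1` of `L⁻¹`. -/
def tildeL {p : ℕ} (x : Fin (p + 1) → ℝ) : Matrix (Fin (p + 1)) (Fin (p + 1)) ℝ :=
  Matrix.of fun i j =>
    Fin.cases (motive := fun _ => ℝ) (-(dgMatrix x)⁻¹ 0 j)
      (fun m => (dgMatrix x)⁻¹ m.castSucc j - (dgMatrix x)⁻¹ m.succ j) i

/-- The image of the reference node `x m` in the interval `[a, a + δ]`. -/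
def node {p : ℕ} (x : Fin (p + 1) → ℝ) (a δ : ℝ) (m : Fin (p + 1)) : ℝ :=
  a + δ / 2 * (x m + 1)

/-- The sum `(δ / 2) ∑ j, L̃ i j * ω j * f (t j, U j)` over the nodes `t j` of `[a, a + δ]`. -/
def sweep {p : ℕ} (f : ℝ → ℝ → ℝ) (x ω : Fin (p + 1) → ℝ) (a δ : ℝ)
    (U : Fin (p + 1) → ℝ) (i : Fin (p + 1)) : ℝ :=
  δ / 2 * ∑ j, tildeL x i j * ω j * f (node x a δ j) (U j)

/-- One iteration `U ↦ V` of the explicit SDG scheme on `[a, a + δ]` with initial value `v` at `a`. -/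
structure IsExplicitStep {p : ℕ} (f : ℝ → ℝ → ℝ) (x ω : Fin (p + 1) → ℝ) (a δ v : ℝ)
    (U V : Fin (p + 1) → ℝ) : Prop where
  zero : V 0 = v + sweep f x ω a δ U 0
  succ : ∀ m : Fin p, V m.succ = V m.castSucc
    + δ / 2 * ω m.castSucc *
      (f (node x a δ m.castSucc) (V m.castSucc) - f (node x a δ m.castSucc) (U m.castSucc))
    + sweep f x ω a δ U m.succ

/-- One iteration `U ↦ V` of the implicit SDG scheme on `[a, a + δ]` with initial value `v` at `a`:
`V` solves the implicit equations of the scheme. -/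
structure IsImplicitStep {p : ℕ} (f : ℝ → ℝ → ℝ) (x ω : Fin (p + 1) → ℝ) (a δ v : ℝ)
    (U V : Fin (p + 1) → ℝ) : Prop where
  zero : V 0 = v + δ / 2 * ω 0 * (f (node x a δ 0) (V 0) - f (node x a δ 0) (U 0))
    + sweep f x ω a δ U 0
  succ : ∀ m : Fin p, V m.succ = V m.castSucc
    + δ / 2 * ω m.succ * (f (node x a δ m.succ) (V m.succ) - f (node x a δ m.succ) (U m.succ))
    + sweep f x ω a δ U m.succ

/-- `V` is obtained by marching through the nodes of `[a, a + δ]` with the explicit Euler method,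
starting from the value `v` at `a`. -/
structure IsExplicitEuler {p : ℕ} (f : ℝ → ℝ → ℝ) (x : Fin (p + 1) → ℝ) (a δ v : ℝ)
    (V : Fin (p + 1) → ℝ) : Prop where
  zero : V 0 = v + (node x a δ 0 - a) * f a v
  succ : ∀ m : Fin p, V m.succ = V m.castSucc
    + (node x a δ m.succ - node x a δ m.castSucc) * f (node x a δ m.castSucc) (V m.castSucc)

/-- `V` is obtained by marching through the nodes of `[a, a + δ]` with the implicit Euler method,
starting from the value `v` at `a`. -/
structure IsImplicitEuler {p : ℕ} (f : ℝ → ℝ → ℝ) (x : Fin (p + 1) → ℝ) (a δ v : ℝ)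
    (V : Fin (p + 1) → ℝ) : Prop where
  zero : V 0 = v + (node x a δ 0 - a) * f (node x a δ 0) (V 0)
  succ : ∀ m : Fin p, V m.succ = V m.castSucc
    + (node x a δ m.succ - node x a δ m.castSucc) * f (node x a δ m.succ) (V m.succ)

/-- `U 0, …, U K` are the iterates of the explicit SDG scheme started from `V`. -/
def IsExplicitIteration {p K : ℕ} (f : ℝ → ℝ → ℝ) (x ω : Fin (p + 1) → ℝ) (a δ v : ℝ)
    (V : Fin (p + 1) → ℝ) (U : Fin (K + 1) → Fin (p + 1) → ℝ) : Prop :=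
  U 0 = V ∧ ∀ k : Fin K, IsExplicitStep f x ω a δ v (U k.castSucc) (U k.succ)

/-- `U 0, …, U K` are iterates of the implicit SDG scheme started from `V`. -/
def IsImplicitIteration {p K : ℕ} (f : ℝ → ℝ → ℝ) (x ω : Fin (p + 1) → ℝ) (a δ v : ℝ)
    (V : Fin (p + 1) → ℝ) (U : Fin (K + 1) → Fin (p + 1) → ℝ) : Prop :=
  U 0 = V ∧ ∀ k : Fin K, IsImplicitStep f x ω a δ v (U k.castSucc) (U k.succ)

/-- The nodal values `V` are within `r` of the values of `u` at the nodes of `[a, a + δ]`. -/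
def NodalClose {p : ℕ} (u : ℝ → ℝ) (x : Fin (p + 1) → ℝ) (a δ r : ℝ)
    (V : Fin (p + 1) → ℝ) : Prop :=
  ∀ m, |u (node x a δ m) - V m| ≤ r

/-- The error bounds of order `min (p + 2) (K + 2)` at the nodes other than the right endpoint and of
order `min (2 p + 2) (K + 2)` at the right endpoint, for the nodal values `V` on `[a, a + δ]`. -/
def ErrorBounds {p : ℕ} (K : ℕ) (u : ℝ → ℝ) (x : Fin (p + 1) → ℝ) (a δ C h : ℝ)
    (V : Fin (p + 1) → ℝ) : Prop :=
  (∀ m : Fin p, |u (node x a δ m.castSucc) - V m.castSucc| ≤ C * h ^ min (p + 2) (K + 2)) ∧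
    |u (a + δ) - V (Fin.last p)| ≤ C * h ^ min (2 * p + 2) (K + 2)

/-- `0 = t 0 < t 1 < ⋯ < t N = T`. -/
structure IsPartition {N : ℕ} (T : ℝ) (t : Fin (N + 1) → ℝ) : Prop where
  strictMono : StrictMono t
  zero_eq : t 0 = 0
  last_eq : t (Fin.last N) = T

/-- The length of the subinterval with index `n`. -/
def stepSize {N : ℕ} (t : Fin (N + 1) → ℝ) (n : Fin N) : ℝ := t n.succ - t n.castSucc

/-- The largest length of a subinterval. -/
def mesh {N : ℕ} (t : Fin (N + 1) → ℝ) : ℝ := ⨆ n : Fin N, stepSize t n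

end SDG

end

open Polynomial

noncomputable section

namespace SDG

/-! ### Quadrature and the matrix of the scheme -/

/-! Both SDG schemes are deferred corrections for Radau IIA collocation. Let `A i j = ∫_{-1}^{x i} ℓ
j`. Integration by parts and Radau exactness give `L A = -diag ω`
(`dgMatrix_mul_collocationMatrix`), so the rows of `L̃ diag ω` are the increments of the rows of
`A`, and the sums in the schemes telescope to collocation quadratures. Fixed points of either scheme
solve the collocation equations `U = u_n + (δ/2) A f(U)`.

These equations are never solved; instead the residual of the iterates is followed. A start with
error `O(h^2)` has residual `O(h^2)`, and each iteration multiplies the residual by `O(δ)`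
(`ResidualLE.of_step`), so the `K`-th residual is `ρ = O(h^(K+2))`.

At the nodes, quadrature accuracy and a contraction argument turn `ρ` into an error `O(ρ + δ^(p+2))`
(`exists_node_error_and_residual_bounds`). At the right endpoint duality gives `O(ρ + δ^(2p+2))`
(`exists_endpoint_error_bound`): the error is tested against the degree `p` Taylor polynomial `q` of
an adjoint solution. For the collocation polynomial `W`, the product `q W` has degree at most
`2p+1`, so its derivative is integrated exactly and no derivative bounds on `W` are needed;
quadrature error comes only from `q u`.

Since `f` is only locally Lipschitz, the estimates live in a tube around the graph of `u`. Explicit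
values are shown to stay there, and implicit equations are solved there uniquely, node by node. -/

theorem exists_polynomial_antiderivative (q : ℝ[X]) (c v : ℝ) :
    ∃ Q : ℝ[X], derivative Q = q ∧ Q.eval c = v ∧ Q.natDegree ≤ q.natDegree + 1 := by
  let Q₀ : ℝ[X] := ∑ i ∈ Finset.range (q.natDegree + 1), C (q.coeff i / (i + 1)) * X ^ (i + 1)
  have hd : derivative Q₀ = q := by
    conv_rhs => rw [q.as_sum_range_C_mul_X_pow]
    simp only [Q₀, derivative_sum, derivative_C_mul, derivative_X_pow]
    refine Finset.sum_congr rfl fun i _ => ?_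
    rw [← mul_assoc, ← C_mul]
    congr 2
    push_cast
    field_simp
  have hdeg : Q₀.natDegree ≤ q.natDegree + 1 := by
    refine natDegree_sum_le_of_forall_le _ _ fun i hi => ?_
    refine (natDegree_C_mul_X_pow_le _ _).trans ?_
    have := Finset.mem_range.1 hi
    omega
  refine ⟨Q₀ + C (v - Q₀.eval c), by simp [hd], by simp, ?_⟩
  refine (natDegree_add_le _ _).trans ?_
  simp [hdeg]

theorem integral_derivative_eval (Q : ℝ[X]) (a b : ℝ) :
    ∫ s in a..b, (derivative Q).eval s = Q.eval b - Q.eval a :=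
  intervalIntegral.integral_eq_sub_of_hasDerivAt (fun s _ => Q.hasDerivAt s)
    ((derivative Q).continuous.intervalIntegrable _ _)

variable {p : ℕ} {x ω : Fin (p + 1) → ℝ}

theorem eval_ell (hx : Function.Injective x) (i j : Fin (p + 1)) :
    (ell x i).eval (x j) = if i = j then 1 else 0 := by
  split_ifs with h
  · subst h
    exact Lagrange.eval_basis_self hx.injOn (Finset.mem_univ _)
  · exact Lagrange.eval_basis_of_ne h (Finset.mem_univ _)

theorem natDegree_ell (hx : Function.Injective x) (i : Fin (p + 1)) : (ell x i).natDegree = p := by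
  simpa [ell] using Lagrange.natDegree_basis hx.injOn (Finset.mem_univ i)

theorem eq_sum_ell (hx : Function.Injective x) {q : ℝ[X]} (hq : q.natDegree ≤ p) :
    q = ∑ j, C (q.eval (x j)) * ell x j := by
  have h := Lagrange.eq_interpolate (s := Finset.univ) (f := q) hx.injOn (by
    rw [Finset.card_univ, Fintype.card_fin]
    exact (degree_le_of_natDegree_le hq).trans_lt (by exact_mod_cast Nat.lt_succ_self p))
  rw [Lagrange.interpolate_apply] at h
  exact h

/-- The Runge-Kutta matrix `∫_{-1}^{x i} ℓ j` of the collocation method with the nodes `x`. -/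
def collocationMatrix (x : Fin (p + 1) → ℝ) : Matrix (Fin (p + 1)) (Fin (p + 1)) ℝ :=
  Matrix.of fun i j => ∫ s in (-1 : ℝ)..x i, (ell x j).eval s

theorem eval_sub_eval_eq_sum_collocationMatrix (hx : Function.Injective x) {P : ℝ[X]}
    (hP : P.natDegree ≤ p + 1) (i : Fin (p + 1)) :
    P.eval (x i) - P.eval (-1) = ∑ j, collocationMatrix x i j * (derivative P).eval (x j) := by
  have hd : (derivative P).natDegree ≤ p := (natDegree_derivative_le P).trans (by omega)
  rw [← integral_derivative_eval, eq_sum_ell hx hd]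
  simp only [eval_finsetSum, eval_mul, eval_C, eval_ell hx]
  rw [intervalIntegral.integral_finsetSum]
  · refine Finset.sum_congr rfl fun j _ => ?_
    rw [intervalIntegral.integral_const_mul]
    simp [collocationMatrix, mul_comm]
  · intro j _
    exact (continuous_const.mul (ell x j).continuous).intervalIntegrable _ _

namespace IsRightGaussRadau

variable (hx : IsRightGaussRadau p x ω)
include hx

theorem injective : Function.Injective x := hx.strictMono.injective

theorem mem_Icc (i : Fin (p + 1)) : x i ∈ Set.Icc (-1 : ℝ) 1 :=
  ⟨hx.left_lt.le.trans (hx.strictMono.monotone (Fin.zero_le i)),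
    hx.last_eq ▸ hx.strictMono.monotone (Fin.le_last i)⟩

/-- The square of `ℓ k` has degree `2p`, the limit of exactness, and vanishes at every node but `x
k`. This is the source of the positivity of the weights. -/
theorem weight_eq_integral_sq (k : Fin (p + 1)) :
    ω k = ∫ s in (-1 : ℝ)..1, (ell x k).eval s ^ 2 := by
  have h := hx.exact (ell x k ^ 2) (natDegree_pow_le.trans (by rw [natDegree_ell hx.injective]))
  simpa [eval_ell hx.injective] using h

theorem weight_nonneg (k : Fin (p + 1)) : 0 ≤ ω k := by
  rw [hx.weight_eq_integral_sq]
  exact intervalIntegral.integral_nonneg (by norm_num) fun _ _ => sq_nonneg _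

theorem weight_pos (k : Fin (p + 1)) : 0 < ω k := by
  rw [hx.weight_eq_integral_sq]
  refine intervalIntegral.integral_pos (by norm_num)
    ((ell x k).continuous.pow 2).continuousOn (fun _ _ => sq_nonneg _) ⟨x k, hx.mem_Icc k, ?_⟩
  simp [eval_ell hx.injective]

theorem eval_sub_eval_eq_sum {P : ℝ[X]} (hP : P.natDegree ≤ 2 * p + 1) :
    P.eval 1 - P.eval (-1) = ∑ j, ω j * (derivative P).eval (x j) := by
  rw [hx.exact _ ((natDegree_derivative_le P).trans (by omega)), integral_derivative_eval]

theorem collocationMatrix_last (j : Fin (p + 1)) : collocationMatrix x (Fin.last p) j = ω j := by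
  have h := hx.exact (ell x j) (by rw [natDegree_ell hx.injective]; omega)
  simp only [collocationMatrix, Matrix.of_apply, hx.last_eq, ← h]
  simp [eval_ell hx.injective]

/-- Let `Q' = ℓ k` and `Q(-1) = 0`, so that column `k` of the collocation matrix is `Q` at the
nodes. As `ℓ i' Q` has degree at most `2p`, its Radau sum is `∫ ℓ i' Q = ℓ i(1) Q(1) - ∫ ℓ i ℓ k`.
The boundary term is cancelled by the `-δ_{ip} δ_{jp}` in `L`, and the last integral is `ω i
δ_{ik}`, again by exactness. -/
theorem dgMatrix_mul_collocationMatrix :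
    dgMatrix x * collocationMatrix x = -Matrix.diagonal ω := by
  ext i k
  obtain ⟨Q, hQ, hQ1, hQd⟩ := exists_polynomial_antiderivative (ell x k) (-1) 0
  have hA : ∀ j, collocationMatrix x j k = Q.eval (x j) := fun j => by
    simp only [collocationMatrix, Matrix.of_apply]
    rw [← hQ, integral_derivative_eval, hQ1, sub_zero]
  have hdeg : ∀ i, (ell x i).natDegree = p := natDegree_ell hx.injective
  have hL : ∀ j, dgMatrix x i j = ω j * (derivative (ell x i)).eval (x j)
      - if i = Fin.last p ∧ j = Fin.last p then 1 else 0 := fun j => by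
    have h := hx.exact (derivative (ell x i) * ell x j) (natDegree_mul_le.trans (by
      have := natDegree_derivative_le (ell x i)
      rw [hdeg] at *
      omega))
    simp only [eval_mul, eval_ell hx.injective] at h
    simp only [dgMatrix, Matrix.of_apply, ← h]
    simp
  have hd1 : (derivative (ell x i) * Q).natDegree ≤ 2 * p := by
    -- For `p = 0` truncated subtraction would only give the degree bound `1`; there the derivative
    -- of `ℓ i` is zero.
    rcases Nat.eq_zero_or_pos p with h0 | h0
    · rw [derivative_of_natDegree_zero ((hdeg i).trans h0), zero_mul, natDegree_zero]
      exact Nat.zero_le _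
    · have h := natDegree_derivative_le (ell x i)
      rw [hdeg] at hQd h
      refine natDegree_mul_le.trans ?_
      omega
  have h1 := hx.exact _ hd1
  have h2 := hx.exact (ell x i * ell x k) (natDegree_mul_le.trans (by rw [hdeg, hdeg]; omega))
  have h3 := integral_derivative_eval (ell x i * Q) (-1) 1
  have h4 : (ell x i).eval 1 = if i = Fin.last p then 1 else 0 := by
    simpa only [hx.last_eq] using eval_ell hx.injective i (Fin.last p)
  simp only [derivative_mul, hQ, eval_add] at h3
  rw [intervalIntegral.integral_add ((Polynomial.continuous _).intervalIntegrable _ _)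
    ((Polynomial.continuous _).intervalIntegrable _ _), ← h1, ← h2] at h3
  simp only [eval_mul, hQ1, h4, eval_ell hx.injective, mul_zero, sub_zero] at h3
  simp only [Matrix.mul_apply, hA, hL, sub_mul, Finset.sum_sub_distrib, Matrix.neg_apply,
    Matrix.diagonal_apply]
  have h5 : ∑ j, (if i = Fin.last p ∧ j = Fin.last p then (1 : ℝ) else 0) * Q.eval (x j)
      = (if i = Fin.last p then 1 else 0) * Q.eval 1 := by
    rw [← hx.last_eq]
    by_cases h : i = Fin.last p <;> simp [h]
  have h6 : ∑ j, ω j * ((if i = j then (1 : ℝ) else 0) * if k = j then 1 else 0)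
      = if i = k then ω i else 0 := by
    by_cases h : i = k
    · subst h
      simp
    · simp [h]
  rw [h5, ← h3, h6]
  simp only [mul_assoc]
  ring

theorem dgMatrix_inv_mul_weight (i j : Fin (p + 1)) :
    (dgMatrix x)⁻¹ i j * ω j = -collocationMatrix x i j := by
  have hdet : IsUnit (dgMatrix x).det := by
    have h := congrArg Matrix.det hx.dgMatrix_mul_collocationMatrix
    rw [Matrix.det_mul, Matrix.det_neg, Matrix.det_diagonal] at h
    refine isUnit_iff_ne_zero.2 fun h0 => ?_
    rw [h0, zero_mul] at h
    exact mul_ne_zero (pow_ne_zero _ (by norm_num))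
      (Finset.prod_ne_zero_iff.2 fun k _ => (hx.weight_pos k).ne') h.symm
  have h := congrArg (fun M => ((dgMatrix x)⁻¹ * M) i j) hx.dgMatrix_mul_collocationMatrix
  simp only [Matrix.nonsing_inv_mul_cancel_left _ _ hdet, Matrix.mul_neg, Matrix.neg_apply,
    Matrix.mul_diagonal] at h
  linarith

/-- With the next lemma: weighted by `ω`, the rows of `L̃` are the successive increments of the
collocation rows, starting from zero at the left endpoint. -/
theorem tildeL_zero_mul_weight (j : Fin (p + 1)) :
    tildeL x 0 j * ω j = collocationMatrix x 0 j := by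
  have h := hx.dgMatrix_inv_mul_weight 0 j
  simp only [tildeL, Matrix.of_apply, Fin.cases_zero]
  linarith

theorem tildeL_succ_mul_weight (m : Fin p) (j : Fin (p + 1)) :
    tildeL x m.succ j * ω j = collocationMatrix x m.succ j - collocationMatrix x m.castSucc j := by
  have h := hx.dgMatrix_inv_mul_weight m.succ j
  have h' := hx.dgMatrix_inv_mul_weight m.castSucc j
  simp only [tildeL, Matrix.of_apply, Fin.cases_succ]
  linarith

end IsRightGaussRadau

/-- The collocation quadrature of the values `g` at the nodes of an interval of length `δ`. -/
def colloc (x : Fin (p + 1) → ℝ) (δ : ℝ) (g : Fin (p + 1) → ℝ) (i : Fin (p + 1)) : ℝ :=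
  δ / 2 * ∑ j, collocationMatrix x i j * g j

theorem colloc_sub (δ : ℝ) (g h : Fin (p + 1) → ℝ) (i : Fin (p + 1)) :
    colloc x δ (fun j => g j - h j) i = colloc x δ g i - colloc x δ h i := by
  simp only [colloc, mul_sub, Finset.sum_sub_distrib]

/-- A bound for the absolute row sums of the collocation matrix. -/
def collocBound (x : Fin (p + 1) → ℝ) : ℝ := ∑ i, ∑ j, |collocationMatrix x i j|

theorem collocBound_nonneg (x : Fin (p + 1) → ℝ) : 0 ≤ collocBound x :=
  Finset.sum_nonneg fun _ _ => Finset.sum_nonneg fun _ _ => abs_nonneg _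

theorem abs_colloc_le {δ c : ℝ} (hδ : 0 ≤ δ) (hc : 0 ≤ c) {g : Fin (p + 1) → ℝ}
    (hg : ∀ j, |g j| ≤ c) (i : Fin (p + 1)) : |colloc x δ g i| ≤ collocBound x * δ * c := by
  have h1 : |∑ j, collocationMatrix x i j * g j| ≤ collocBound x * c := by
    calc |∑ j, collocationMatrix x i j * g j|
        ≤ ∑ j, |collocationMatrix x i j| * c := by
          refine (Finset.abs_sum_le_sum_abs _ _).trans (Finset.sum_le_sum fun j _ => ?_)
          rw [abs_mul]
          exact mul_le_mul_of_nonneg_left (hg j) (abs_nonneg _)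
      _ = (∑ j, |collocationMatrix x i j|) * c := by rw [Finset.sum_mul]
      _ ≤ collocBound x * c := by
          refine mul_le_mul_of_nonneg_right ?_ hc
          exact Finset.single_le_sum (f := fun i => ∑ j, |collocationMatrix x i j|)
            (fun _ _ => Finset.sum_nonneg fun _ _ => abs_nonneg _) (Finset.mem_univ i)
  rw [colloc, abs_mul, abs_of_nonneg (by positivity)]
  calc δ / 2 * |∑ j, collocationMatrix x i j * g j| ≤ δ * (collocBound x * c) := by
        refine mul_le_mul (by linarith) h1 (abs_nonneg _) hδ
    _ = collocBound x * δ * c := by ring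

theorem colloc_last (hx : IsRightGaussRadau p x ω) (δ : ℝ) (g : Fin (p + 1) → ℝ) :
    colloc x δ g (Fin.last p) = δ / 2 * ∑ j, ω j * g j := by
  simp only [colloc, hx.collocationMatrix_last]

/-! ### Polynomials on a subinterval -/

theorem eval_node_sub_eval_eq_colloc (hx : IsRightGaussRadau p x ω) (a δ : ℝ) {P : ℝ[X]}
    (hP : P.natDegree ≤ p + 1) (i : Fin (p + 1)) :
    P.eval (node x a δ i) - P.eval a
      = colloc x δ (fun j => (derivative P).eval (node x a δ j)) i := by
  -- The affine map from the reference interval onto `[a, a + δ]`; composing with it does not raise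
  -- the degree.
  set S : ℝ[X] := C a + C (δ / 2) * (X + 1) with hS
  have hSd : S.natDegree ≤ 1 := by rw [hS]; compute_degree
  have hSe : ∀ y, S.eval y = a + δ / 2 * (y + 1) := fun y => by simp [hS]
  have h := eval_sub_eval_eq_sum_collocationMatrix hx.injective (P := P.comp S)
    (natDegree_comp_le.trans (by nlinarith)) i
  simp only [derivative_comp, eval_comp, eval_mul, hSe] at h
  have hS' : derivative S = C (δ / 2) := by simp [hS]
  simp only [hS', eval_C] at h
  rw [colloc, Finset.mul_sum]
  simp only [node]
  rw [show a + δ / 2 * (-1 + 1) = a by ring] at h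
  rw [h]
  exact Finset.sum_congr rfl fun j _ => by ring

/-- The last collocation row is the Radau rule itself, so exactness there reaches degree `2p + 1`
instead of `p + 1`. -/
theorem eval_add_sub_eval_eq_colloc (hx : IsRightGaussRadau p x ω) (a δ : ℝ) {P : ℝ[X]}
    (hP : P.natDegree ≤ 2 * p + 1) :
    P.eval (a + δ) - P.eval a
      = colloc x δ (fun j => (derivative P).eval (node x a δ j)) (Fin.last p) := by
  set S : ℝ[X] := C a + C (δ / 2) * (X + 1) with hS
  have hSd : S.natDegree ≤ 1 := by rw [hS]; compute_degree
  have hSe : ∀ y, S.eval y = a + δ / 2 * (y + 1) := fun y => by simp [hS]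
  have h := hx.eval_sub_eval_eq_sum (P := P.comp S)
    (natDegree_comp_le.trans (by nlinarith))
  simp only [derivative_comp, eval_comp, eval_mul, hSe] at h
  have hS' : derivative S = C (δ / 2) := by simp [hS]
  simp only [hS', eval_C] at h
  rw [colloc_last hx, Finset.mul_sum]
  simp only [node]
  rw [show a + δ / 2 * (-1 + 1) = a by ring, show a + δ / 2 * (1 + 1) = a + δ by ring] at h
  rw [h]
  exact Finset.sum_congr rfl fun j _ => by ring

theorem node_injective (hx : IsRightGaussRadau p x ω) (a : ℝ) {δ : ℝ} (hδ : 0 < δ) :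
    Function.Injective (node x a δ) := fun i j h => by
  simp only [node, add_right_inj, mul_eq_mul_left_iff, add_left_inj] at h
  exact hx.injective (h.resolve_right (by positivity))

theorem node_last (hx : IsRightGaussRadau p x ω) (a δ : ℝ) :
    node x a δ (Fin.last p) = a + δ := by
  rw [node, hx.last_eq]
  ring

theorem node_mem (hx : IsRightGaussRadau p x ω) (a : ℝ) {δ : ℝ} (hδ : 0 ≤ δ) (i : Fin (p + 1)) :
    node x a δ i ∈ Set.Icc a (a + δ) := by
  obtain ⟨h1, h2⟩ := hx.mem_Icc i
  constructor <;> simp only [node] <;> nlinarith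

/-- The polynomial of degree at most `p + 1` with prescribed value at `a` and prescribed
derivatives at the nodes. -/
theorem exists_polynomial_derivative_eval_node (hx : IsRightGaussRadau p x ω) (a v : ℝ) {δ : ℝ}
    (hδ : 0 < δ) (g : Fin (p + 1) → ℝ) :
    ∃ W : ℝ[X], W.natDegree ≤ p + 1 ∧ W.eval a = v ∧
      (∀ j, (derivative W).eval (node x a δ j) = g j) ∧
      ∀ i, W.eval (node x a δ i) = v + colloc x δ g i := by
  have hinj := node_injective hx a hδ
  set q := Lagrange.interpolate Finset.univ (node x a δ) g
  have hq : ∀ j, q.eval (node x a δ j) = g j := fun j =>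
    Lagrange.eval_interpolate_at_node _ hinj.injOn (Finset.mem_univ j)
  have hqd : q.natDegree ≤ p := by
    have h := Lagrange.degree_interpolate_lt (s := Finset.univ) g hinj.injOn
    rw [Finset.card_univ, Fintype.card_fin] at h
    exact natDegree_le_of_degree_le (Order.le_of_lt_succ (by exact_mod_cast h))
  obtain ⟨W, hW, hWa, hWd⟩ := exists_polynomial_antiderivative q a v
  have hWd' : W.natDegree ≤ p + 1 := hWd.trans (by omega)
  refine ⟨W, hWd', hWa, fun j => by rw [hW, hq], fun i => ?_⟩
  have h := eval_node_sub_eval_eq_colloc hx a δ hWd' i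
  simp only [hW, hq, hWa] at h
  linarith

/-! ### Smooth extension of the exact solution -/

theorem exists_primitive_extension {T : ℝ} (hT : 0 < T) {u g : ℝ → ℝ} {F : ℝ → ℝ}
    (hg : Continuous g) (hgF : ∀ s ∈ Set.Icc 0 T, g s = F s)
    (hu : ∀ s ∈ Set.Icc 0 T, HasDerivWithinAt u (F s) (Set.Icc 0 T) s) :
    ∃ w : ℝ → ℝ, (∀ s, HasDerivAt w (g s) s) ∧ ∀ s ∈ Set.Icc 0 T, w s = u s := by
  have hw : ∀ s, HasDerivAt (fun t => u 0 + ∫ r in (0 : ℝ)..t, g r) (g s) s := fun s =>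
    (intervalIntegral.integral_hasDerivAt_right (hg.intervalIntegrable _ _)
      hg.stronglyMeasurable.stronglyMeasurableAtFilter hg.continuousAt).const_add _
  refine ⟨_, hw, ?_⟩
  refine eq_of_derivWithin_eq (f := fun t => u 0 + ∫ r in (0 : ℝ)..t, g r) (g := u)
    (fun s _ => (hw s).differentiableAt.differentiableWithinAt)
    (fun s hs => (hu s hs).differentiableWithinAt) (fun s hs => ?_) (by simp)
  have hs' : s ∈ Set.Icc 0 T := Set.Ico_subset_Icc_self hs
  have hud : UniqueDiffWithinAt ℝ (Set.Icc 0 T) s := uniqueDiffOn_Icc hT s hs'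
  rw [(hw s).hasDerivWithinAt.derivWithin hud, (hu s hs').derivWithin hud, hgF s hs']

theorem contDiff_succ_of_hasDerivAt {n : ℕ} {w g : ℝ → ℝ} (hw : ∀ s, HasDerivAt w (g s) s)
    (hg : ContDiff ℝ n g) : ContDiff ℝ (n + 1 : ℕ) w := by
  have hd : deriv w = g := funext fun s => (hw s).deriv
  push_cast
  rw [contDiff_succ_iff_deriv]
  exact ⟨fun s => (hw s).differentiableAt, by simp, hd ▸ hg⟩

/-- Bootstrapping: if `w` is a `C^k` extension of `u`, then `s ↦ f s (w s)` is `C^k` on the whole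
line and its primitive is a `C^(k+1)` extension. The induction starts from the extension of `u` by
constants. The last primitive has a two-sided derivative even at `0` and `T`. -/
theorem exists_contDiff_extension {T : ℝ} (hT : 0 < T) {n : ℕ} {f : ℝ → ℝ → ℝ}
    (hf : ContDiff ℝ n (fun z : ℝ × ℝ => f z.1 z.2)) {u : ℝ → ℝ}
    (hu : ∀ s ∈ Set.Icc 0 T, HasDerivWithinAt u (f s (u s)) (Set.Icc 0 T) s) :
    ∃ w : ℝ → ℝ, ContDiff ℝ (n + 1 : ℕ) w ∧ (∀ s ∈ Set.Icc 0 T, w s = u s) ∧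
      ∀ s ∈ Set.Icc 0 T, HasDerivAt w (f s (w s)) s := by
  have step : ∀ k : ℕ, k ≤ n → ∀ w : ℝ → ℝ, ContDiff ℝ k w → (∀ s ∈ Set.Icc 0 T, w s = u s) →
      ∃ w' : ℝ → ℝ, ContDiff ℝ (k + 1 : ℕ) w' ∧ (∀ s ∈ Set.Icc 0 T, w' s = u s) ∧
        ∀ s ∈ Set.Icc 0 T, HasDerivAt w' (f s (w' s)) s := by
    intro k hk w hw hwu
    have hg : ContDiff ℝ k (fun s => f s (w s)) :=
      (hf.of_le (by exact_mod_cast hk)).comp (contDiff_id.prodMk hw)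
    obtain ⟨w', hw', hw'u⟩ := exists_primitive_extension hT hg.continuous
      (F := fun s => f s (u s)) (fun s hs => by rw [hwu s hs]) hu
    refine ⟨w', contDiff_succ_of_hasDerivAt hw' hg, hw'u, fun s hs => ?_⟩
    rw [hw'u s hs, ← hwu s hs]
    exact hw' s
  have smooth : ∀ k : ℕ, k ≤ n →
      ∃ w : ℝ → ℝ, ContDiff ℝ k w ∧ ∀ s ∈ Set.Icc 0 T, w s = u s := by
    intro k
    induction k with
    | zero =>
      intro _
      have hc : ContinuousOn u (Set.Icc 0 T) := fun s hs => (hu s hs).continuousWithinAt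
      refine ⟨Set.IccExtend hT.le (Set.domRestrict (Set.Icc 0 T) u), ?_, fun s hs => ?_⟩
      · exact contDiff_zero.2 hc.domRestrict.Icc_extend'
      · exact Set.IccExtend_of_mem hT.le _ hs
    | succ k ih =>
      intro hk
      obtain ⟨w, hw, hwu⟩ := ih (by omega)
      obtain ⟨w', h1, h2, -⟩ := step k (by omega) w hw hwu
      exact ⟨w', h1, h2⟩
  obtain ⟨w, hw, hwu⟩ := smooth n le_rfl
  exact step n le_rfl w hw hwu

/-! ### Taylor polynomials with a movable centre -/

/-- The Taylor polynomial of degree less than `r` of `G` at `b`. -/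
def taylorPoly (G : ℝ → ℝ) (r : ℕ) (b : ℝ) : ℝ[X] :=
  ∑ k ∈ Finset.range r, C (iteratedDeriv k G b / (k.factorial : ℝ)) * (X - C b) ^ k

theorem natDegree_taylorPoly_succ (G : ℝ → ℝ) (r : ℕ) (b : ℝ) :
    (taylorPoly G (r + 1) b).natDegree ≤ r := by
  refine natDegree_sum_le_of_forall_le _ _ fun k hk => (natDegree_C_mul_le _ _).trans ?_
  rw [natDegree_pow, natDegree_X_sub_C, mul_one]
  exact Nat.lt_succ_iff.1 (Finset.mem_range.1 hk)

theorem eval_taylorPoly_self (G : ℝ → ℝ) (r : ℕ) (b : ℝ) :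
    (taylorPoly G (r + 1) b).eval b = G b := by
  simp [taylorPoly, eval_finsetSum, Finset.sum_range_succ']

theorem derivative_taylorPoly_succ (G : ℝ → ℝ) (r : ℕ) (b : ℝ) :
    derivative (taylorPoly G (r + 1) b) = taylorPoly (deriv G) r b := by
  simp only [taylorPoly, Finset.sum_range_succ', derivative_add, derivative_sum]
  simp only [pow_zero, mul_one, derivative_C, add_zero]
  refine Finset.sum_congr rfl fun k _ => ?_
  rw [derivative_C_mul, derivative_X_sub_C_pow, iteratedDeriv_succ', ← mul_assoc, ← C_mul,
    add_tsub_cancel_right]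
  congr 2
  rw [Nat.factorial_succ]
  push_cast
  field_simp

/-- The derivative of a Taylor remainder of `G` is the remainder of `G'` of one order less, so
induction with the mean value inequality applies. The constant does not depend on the centre, and
`t` may lie on either side of it. -/
theorem exists_taylorPoly_bound (T : ℝ) (r : ℕ) : ∀ {G : ℝ → ℝ}, ContDiff ℝ r G →
    ∃ M : ℝ, 0 ≤ M ∧ ∀ b ∈ Set.Icc 0 T, ∀ t ∈ Set.Icc 0 T,
      |G t - (taylorPoly G r b).eval t| ≤ M * |t - b| ^ r := by
  induction r with
  | zero =>
    intro G hG
    obtain ⟨M, hM⟩ := (isCompact_Icc (a := (0 : ℝ)) (b := T)).exists_bound_of_continuousOn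
      hG.continuous.continuousOn
    refine ⟨max M 0, le_max_right _ _, fun b _ t ht => ?_⟩
    simpa [taylorPoly] using Or.inl (hM t ht)
  | succ r ih =>
    intro G hG
    push_cast at hG
    rw [contDiff_succ_iff_deriv] at hG
    obtain ⟨M, hM0, hM⟩ := ih hG.2.2
    refine ⟨M, hM0, fun b hb t ht => ?_⟩
    have hd : ∀ s, HasDerivAt (fun t => G t - (taylorPoly G (r + 1) b).eval t)
        (deriv G s - (taylorPoly (deriv G) r b).eval s) s := fun s => by
      rw [← derivative_taylorPoly_succ]
      exact (hG.1 s).hasDerivAt.sub (Polynomial.hasDerivAt _ _)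
    have hsub : Set.uIcc b t ⊆ Set.Icc 0 T := Set.uIcc_subset_Icc hb ht
    have h := (convex_uIcc b t).norm_image_sub_le_of_norm_hasDerivWithin_le
      (C := M * |t - b| ^ r) (fun s _ => (hd s).hasDerivWithinAt) (fun s hs => ?_)
      Set.left_mem_uIcc Set.right_mem_uIcc
    · simp only [eval_taylorPoly_self, sub_self, sub_zero, Real.norm_eq_abs] at h
      rw [pow_succ, ← mul_assoc]
      exact h
    · refine (hM b hb s (hsub hs)).trans ?_
      refine mul_le_mul_of_nonneg_left (pow_le_pow_left₀ (abs_nonneg _) ?_ _) hM0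
      exact Set.abs_sub_left_of_mem_uIcc hs

/-! ### Quadrature errors -/

/-- The Taylor polynomial of degree `r` at `a` contributes nothing. What is left is the remainder of
`G`, of order `r + 1`, and that of `G'`, of order `r`, which gains a factor `δ` from the quadrature.
-/
theorem exists_colloc_error_bound_of_exact (hx : IsRightGaussRadau p x ω) (T : ℝ) {r : ℕ}
    {i : Fin (p + 1)}
    (hex : ∀ (a δ : ℝ) (P : ℝ[X]), P.natDegree ≤ r → P.eval (node x a δ i) - P.eval a
      = colloc x δ (fun j => (derivative P).eval (node x a δ j)) i)
    {G : ℝ → ℝ} (hG : ContDiff ℝ (r + 1 : ℕ) G) :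
    ∃ M : ℝ, 0 ≤ M ∧ ∀ a δ : ℝ, 0 ≤ a → 0 ≤ δ → a + δ ≤ T →
      |G (node x a δ i) - G a - colloc x δ (fun j => deriv G (node x a δ j)) i|
        ≤ M * δ ^ (r + 1) := by
  obtain ⟨M₁, hM₁, h₁⟩ := exists_taylorPoly_bound T (r + 1) hG
  have hG' := hG
  push_cast at hG'
  rw [contDiff_succ_iff_deriv] at hG'
  obtain ⟨M₂, hM₂, h₂⟩ := exists_taylorPoly_bound T r hG'.2.2
  have hB := collocBound_nonneg x
  refine ⟨M₁ + collocBound x * M₂, by positivity, fun a δ ha hδ haT => ?_⟩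
  have hsub : Set.Icc a (a + δ) ⊆ Set.Icc 0 T := Set.Icc_subset_Icc ha haT
  have hn := node_mem hx a hδ
  have haI : a ∈ Set.Icc 0 T := hsub ⟨le_rfl, by linarith⟩
  have habs : ∀ j, |node x a δ j - a| ≤ δ := fun j => by
    rw [abs_le]
    constructor <;> linarith [(hn j).1, (hn j).2]
  have e := hex a δ _ (natDegree_taylorPoly_succ G r a)
  rw [eval_taylorPoly_self, derivative_taylorPoly_succ] at e
  have e1 : |G (node x a δ i) - (taylorPoly G (r + 1) a).eval (node x a δ i)|
      ≤ M₁ * δ ^ (r + 1) :=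
    (h₁ a haI _ (hsub (hn i))).trans
      (mul_le_mul_of_nonneg_left (pow_le_pow_left₀ (abs_nonneg _) (habs i) _) hM₁)
  have e2 := abs_colloc_le (x := x) hδ (c := M₂ * δ ^ r) (by positivity)
    (g := fun j => deriv G (node x a δ j) - (taylorPoly (deriv G) r a).eval (node x a δ j))
    (fun j => (h₂ a haI _ (hsub (hn j))).trans
      (mul_le_mul_of_nonneg_left (pow_le_pow_left₀ (abs_nonneg _) (habs j) _) hM₂)) i
  rw [colloc_sub] at e2
  have e3 : G (node x a δ i) - G a - colloc x δ (fun j => deriv G (node x a δ j)) i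
      = (G (node x a δ i) - (taylorPoly G (r + 1) a).eval (node x a δ i))
        - (colloc x δ (fun j => deriv G (node x a δ j)) i
          - colloc x δ (fun j => (taylorPoly (deriv G) r a).eval (node x a δ j)) i) := by
    linarith
  rw [e3]
  refine (abs_sub _ _).trans ((add_le_add e1 e2).trans (le_of_eq ?_))
  ring

theorem exists_colloc_error_bound (hx : IsRightGaussRadau p x ω) (T : ℝ) {G : ℝ → ℝ}
    (hG : ContDiff ℝ (p + 2 : ℕ) G) :
    ∃ M : ℝ, 0 ≤ M ∧ ∀ a δ : ℝ, 0 ≤ a → 0 ≤ δ → a + δ ≤ T → ∀ i,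
      |G (node x a δ i) - G a - colloc x δ (fun j => deriv G (node x a δ j)) i|
        ≤ M * δ ^ (p + 2) := by
  have h := fun i => exists_colloc_error_bound_of_exact hx T (r := p + 1) (i := i)
    (fun a δ P hP => eval_node_sub_eval_eq_colloc hx a δ hP i) hG
  choose M hM h using h
  refine ⟨∑ i, M i, Finset.sum_nonneg fun i _ => hM i, fun a δ ha hδ haT i => ?_⟩
  refine (h i a δ ha hδ haT).trans (mul_le_mul_of_nonneg_right ?_ (by positivity))
  exact Finset.single_le_sum (fun i _ => hM i) (Finset.mem_univ i)

theorem exists_colloc_last_error_bound (hx : IsRightGaussRadau p x ω) (T : ℝ) {G : ℝ → ℝ}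
    (hG : ContDiff ℝ (2 * p + 2 : ℕ) G) :
    ∃ M : ℝ, 0 ≤ M ∧ ∀ a δ : ℝ, 0 ≤ a → 0 ≤ δ → a + δ ≤ T →
      |G (a + δ) - G a - colloc x δ (fun j => deriv G (node x a δ j)) (Fin.last p)|
        ≤ M * δ ^ (2 * p + 2) := by
  have h := exists_colloc_error_bound_of_exact hx T (r := 2 * p + 1) (i := Fin.last p)
    (fun a δ P hP => by rw [node_last hx]; exact eval_add_sub_eval_eq_colloc hx a δ hP) hG
  simpa only [node_last hx] using h

/-! ### Bounds near the graph of the exact solution -/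

/-- The tube of radius `R` around the graph lies in a compact box, on which a locally Lipschitz
function is Lipschitz. -/
theorem exists_tube_lipschitz {T : ℝ} {f : ℝ → ℝ → ℝ}
    (hf : ContDiff ℝ 1 (fun z : ℝ × ℝ => f z.1 z.2)) {u : ℝ → ℝ} (hu : Continuous u) (R : ℝ) :
    ∃ Λ : ℝ, 0 ≤ Λ ∧ ∀ s ∈ Set.Icc 0 T, ∀ y z, |u s - y| ≤ R → |u s - z| ≤ R →
      |f s y - f s z| ≤ Λ * |y - z| := by
  obtain ⟨B, hB⟩ := (isCompact_Icc (a := (0 : ℝ)) (b := T)).exists_bound_of_continuousOn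
    hu.continuousOn
  have hK : IsCompact (Set.Icc 0 T ×ˢ Set.Icc (-(B + R)) (B + R)) := isCompact_Icc.prod isCompact_Icc
  obtain ⟨Λ, hΛ⟩ := (hf.locallyLipschitz.locallyLipschitzOn
    (s := Set.Icc 0 T ×ˢ Set.Icc (-(B + R)) (B + R))).exists_lipschitzOnWith_of_compact hK
  have mem : ∀ s ∈ Set.Icc 0 T, ∀ y, |u s - y| ≤ R →
      (s, y) ∈ Set.Icc 0 T ×ˢ Set.Icc (-(B + R)) (B + R) := fun s hs y hy => by
    have h1 := abs_le.1 (hB s hs)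
    have h2 := abs_le.1 hy
    exact ⟨hs, by constructor <;> linarith [h1.1, h1.2, h2.1, h2.2]⟩
  refine ⟨Λ, Λ.2, fun s hs y z hy hz => ?_⟩
  have h := hΛ.dist_le_mul _ (mem s hs y hy) _ (mem s hs z hz)
  simpa [Prod.dist_eq, Real.dist_eq] using h

theorem exists_tube_bound {T : ℝ} {f : ℝ → ℝ → ℝ}
    (hf : Continuous (fun z : ℝ × ℝ => f z.1 z.2)) {u : ℝ → ℝ} (hu : Continuous u) (R : ℝ) :
    ∃ F : ℝ, 0 ≤ F ∧ ∀ s ∈ Set.Icc 0 T, ∀ y, |u s - y| ≤ R → |f s y| ≤ F := by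
  obtain ⟨B, hB⟩ := (isCompact_Icc (a := (0 : ℝ)) (b := T)).exists_bound_of_continuousOn
    hu.continuousOn
  have hK : IsCompact (Set.Icc 0 T ×ˢ Set.Icc (-(B + R)) (B + R)) := isCompact_Icc.prod isCompact_Icc
  obtain ⟨F, hF⟩ := hK.exists_bound_of_continuousOn hf.continuousOn
  refine ⟨max F 0, le_max_right _ _, fun s hs y hy => (hF (s, y) ⟨hs, ?_⟩).trans (le_max_left _ _)⟩
  have h1 := abs_le.1 (hB s hs)
  have h2 := abs_le.1 hy
  constructor <;> linarith [h1.1, h1.2, h2.1, h2.2]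

/-- The partial derivative of `f` in its second argument. -/
def partialSnd (f : ℝ → ℝ → ℝ) (s y : ℝ) : ℝ :=
  fderiv ℝ (fun z : ℝ × ℝ => f z.1 z.2) (s, y) (0, 1)

theorem contDiff_partialSnd {n : ℕ} {f : ℝ → ℝ → ℝ}
    (hf : ContDiff ℝ (n + 1 : ℕ) (fun z : ℝ × ℝ => f z.1 z.2)) :
    ContDiff ℝ n (fun z : ℝ × ℝ => partialSnd f z.1 z.2) :=
  (hf.fderiv_right (m := n) (by push_cast; exact le_rfl)).clm_apply contDiff_const

theorem hasDerivAt_partialSnd {f : ℝ → ℝ → ℝ}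
    (hf : Differentiable ℝ (fun z : ℝ × ℝ => f z.1 z.2)) (s y : ℝ) :
    HasDerivAt (f s) (partialSnd f s y) y := by
  have h := (hf (s, y)).hasFDerivAt.comp_hasDerivAt y
    ((hasDerivAt_const y s).prodMk (hasDerivAt_id y))
  exact h

theorem exists_tube_linearization {T : ℝ} {f : ℝ → ℝ → ℝ}
    (hf : ContDiff ℝ 2 (fun z : ℝ × ℝ => f z.1 z.2)) {u : ℝ → ℝ} (hu : Continuous u) (R : ℝ) :
    ∃ Λ : ℝ, 0 ≤ Λ ∧ ∀ s ∈ Set.Icc 0 T, ∀ y, |u s - y| ≤ R →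
      |f s y - f s (u s) - partialSnd f s (u s) * (y - u s)| ≤ Λ * |y - u s| ^ 2 := by
  obtain ⟨Λ, hΛ, h⟩ := exists_tube_lipschitz (T := T) (contDiff_partialSnd (n := 1) hf) hu R
  refine ⟨Λ, hΛ, fun s hs y hy => ?_⟩
  have hd : ∀ z, HasDerivAt (fun z => f s z - partialSnd f s (u s) * z)
      (partialSnd f s z - partialSnd f s (u s)) z := fun z => by
    have h := (hasDerivAt_partialSnd (hf.differentiable (by norm_num)) s z).sub
      ((hasDerivAt_id z).const_mul (partialSnd f s (u s)))
    rw [mul_one] at h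
    exact h
  have key := (convex_uIcc (u s) y).norm_image_sub_le_of_norm_hasDerivWithin_le
    (C := Λ * |y - u s|) (fun z _ => (hd z).hasDerivWithinAt) (fun z hz => ?_)
    Set.left_mem_uIcc Set.right_mem_uIcc
  · simp only [Real.norm_eq_abs] at key
    rw [pow_two, ← mul_assoc]
    refine le_trans (le_of_eq ?_) key
    congr 1
    ring
  · have hz' : |z - u s| ≤ |y - u s| := Set.abs_sub_left_of_mem_uIcc hz
    have hR : 0 ≤ R := (abs_nonneg _).trans hy
    refine (h s hs z (u s) ?_ (by simpa using hR)).trans (mul_le_mul_of_nonneg_left hz' hΛ)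
    rw [abs_sub_comm]
    rw [abs_sub_comm] at hy
    exact hz'.trans hy

/-! ### Polynomial approximations of the adjoint solution -/

/-- `Φ = exp(-∫ J)` solves the adjoint equation `Φ' = -J Φ`, and `q` is its Taylor polynomial of
degree `p` at `b`. The defect `q' + J q` then has order `p`, limited by the remainder of `Φ'`. The
lower bound at `b` allows division by `q(b) = Φ(b)`; the uniform coefficient bounds serve
`exists_mulError_bound`. -/
theorem exists_adjoint_polynomial (T : ℝ) {J : ℝ → ℝ} (hJ : ContDiff ℝ p J) :
    ∃ c D M : ℝ, 0 < c ∧ 0 ≤ D ∧ 0 ≤ M ∧ ∀ b ∈ Set.Icc 0 T, ∃ q : ℝ[X],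
      q.natDegree ≤ p ∧ c ≤ q.eval b ∧ (∀ k ∈ Finset.range (p + 1), |q.coeff k| ≤ D) ∧
      ∀ t ∈ Set.Icc 0 T, |q.eval t| ≤ D ∧
        |(derivative q).eval t + J t * q.eval t| ≤ M * |t - b| ^ p := by
  set I : ℝ → ℝ := fun t => ∫ r in (0 : ℝ)..t, J r
  have hI : ∀ s, HasDerivAt I (J s) s := fun s =>
    intervalIntegral.integral_hasDerivAt_right (hJ.continuous.intervalIntegrable _ _)
      hJ.continuous.stronglyMeasurable.stronglyMeasurableAtFilter hJ.continuous.continuousAt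
  set Φ : ℝ → ℝ := fun t => Real.exp (-I t) with hΦdef
  have hΦ : ContDiff ℝ (p + 1 : ℕ) Φ := (contDiff_succ_of_hasDerivAt hI hJ).neg.exp
  have hΦ' : deriv Φ = fun t => -(J t * Φ t) := funext fun t => by
    have h : HasDerivAt Φ (Real.exp (-I t) * -J t) t := (hI t).neg.exp
    rw [h.deriv]
    ring
  have hΦd : ContDiff ℝ p (deriv Φ) := by
    have h := hΦ
    push_cast at h
    exact (contDiff_succ_iff_deriv.1 h).2.2
  obtain ⟨M₁, hM₁, h₁⟩ := exists_taylorPoly_bound T (p + 1) hΦ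
  obtain ⟨M₂, hM₂, h₂⟩ := exists_taylorPoly_bound T p hΦd
  obtain ⟨JB, hJB⟩ := (isCompact_Icc (a := (0 : ℝ)) (b := T)).exists_bound_of_continuousOn
    hJ.continuous.continuousOn
  obtain ⟨ΦB, hΦB⟩ := (isCompact_Icc (a := (0 : ℝ)) (b := T)).exists_bound_of_continuousOn
    hΦ.continuous.continuousOn
  obtain ⟨IB, hIB⟩ := (isCompact_Icc (a := (0 : ℝ)) (b := T)).exists_bound_of_continuousOn
    (f := I) (fun s _ => (hI s).continuousAt.continuousWithinAt)
  -- The coefficients depend continuously on the centre, hence are bounded over the compact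
  -- interval.
  have hcoeff : ∀ k, ∃ D, ∀ b ∈ Set.Icc 0 T, ‖(taylorPoly Φ (p + 1) b).coeff k‖ ≤ D := by
    intro k
    refine (isCompact_Icc (a := (0 : ℝ)) (b := T)).exists_bound_of_continuousOn
      (f := fun b => (taylorPoly Φ (p + 1) b).coeff k) (Continuous.continuousOn ?_)
    simp only [taylorPoly, finsetSum_coeff, coeff_C_mul, sub_eq_add_neg, ← C_neg,
      coeff_X_add_C_pow]
    refine continuous_finsetSum _ fun i hi => ?_
    have hi' := Finset.mem_range.1 hi
    have hc : Continuous (iteratedDeriv i Φ) :=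
      hΦ.continuous_iteratedDeriv i (by exact_mod_cast hi'.le)
    fun_prop
  choose D hD using hcoeff
  set D' : ℝ := ∑ k ∈ Finset.range (p + 1), |D k|
  have hD' : 0 ≤ D' := Finset.sum_nonneg fun _ _ => abs_nonneg _
  refine ⟨Real.exp (-IB), max D' (|ΦB| + M₁ * |T| ^ (p + 1)), M₂ + |JB| * (M₁ * |T|),
    Real.exp_pos _, hD'.trans (le_max_left _ _), by positivity, fun b hb =>
    ⟨taylorPoly Φ (p + 1) b, natDegree_taylorPoly_succ _ _ _, ?_, fun k hk => ?_, fun t ht => ?_⟩⟩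
  · rw [eval_taylorPoly_self]
    exact Real.exp_le_exp.2 (neg_le_neg ((le_abs_self _).trans (hIB b hb)))
  · refine ((hD k b hb).trans (le_abs_self _)).trans (le_trans ?_ (le_max_left _ _))
    exact Finset.single_le_sum (f := fun k => |D k|) (fun _ _ => abs_nonneg _) hk
  · have htb : |t - b| ≤ |T| := by
      rw [abs_of_nonneg (hb.1.trans hb.2), abs_le]
      constructor <;> linarith [hb.1, hb.2, ht.1, ht.2]
    have e1 := h₁ b hb t ht
    have e2 := h₂ b hb t ht
    have e3 : M₁ * |t - b| ^ (p + 1) ≤ M₁ * |T| ^ (p + 1) :=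
      mul_le_mul_of_nonneg_left (pow_le_pow_left₀ (abs_nonneg _) htb _) hM₁
    have e4 : M₁ * |t - b| ^ (p + 1) ≤ M₁ * |T| * |t - b| ^ p := by
      rw [pow_succ]
      calc M₁ * (|t - b| ^ p * |t - b|) = M₁ * |t - b| * |t - b| ^ p := by ring
        _ ≤ M₁ * |T| * |t - b| ^ p := by gcongr
    constructor
    · refine le_trans ?_ (le_max_right _ _)
      have e5 : |Φ t| ≤ |ΦB| := (hΦB t ht).trans (le_abs_self _)
      have := abs_sub_abs_le_abs_sub ((taylorPoly Φ (p + 1) b).eval t) (Φ t)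
      rw [abs_sub_comm] at this
      linarith
    · rw [derivative_taylorPoly_succ]
      rw [hΦ'] at e2 ⊢
      have e6 : (taylorPoly (fun t => -(J t * Φ t)) p b).eval t
            + J t * (taylorPoly Φ (p + 1) b).eval t
          = -(-(J t * Φ t) - (taylorPoly (fun t => -(J t * Φ t)) p b).eval t)
            - J t * (Φ t - (taylorPoly Φ (p + 1) b).eval t) := by ring
      rw [e6]
      refine (abs_sub _ _).trans ?_
      rw [abs_neg, abs_mul, add_mul, mul_assoc |JB|]
      refine add_le_add e2 (mul_le_mul ((hJB t ht).trans (le_abs_self _)) (e1.trans e4)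
        (abs_nonneg _) (abs_nonneg _))

/-- The quadrature error, at the right endpoint, for the derivative of a polynomial times `G`. -/
def mulError (x : Fin (p + 1) → ℝ) (a δ : ℝ) (G : ℝ → ℝ) : ℝ[X] →ₗ[ℝ] ℝ where
  toFun P := P.eval (a + δ) * G (a + δ) - P.eval a * G a
    - colloc x δ (fun j => (derivative P).eval (node x a δ j) * G (node x a δ j)
      + P.eval (node x a δ j) * deriv G (node x a δ j)) (Fin.last p)
  map_add' P Q := by
    simp only [colloc, derivative_add, eval_add, add_mul, mul_add, Finset.sum_add_distrib]
    ring
  map_smul' c P := by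
    simp only [colloc, derivative_smul, eval_smul, smul_eq_mul, RingHom.id_apply, mul_sub,
      Finset.mul_sum]
    congr 1
    · ring
    · exact Finset.sum_congr rfl fun j _ => by ring

/-- By linearity in the polynomial it suffices to treat `t^k G(t)` for `k ≤ p`, finitely many fixed
smooth functions. Hence the constant is uniform over all `q` with bounded coefficients. -/
theorem exists_mulError_bound (hx : IsRightGaussRadau p x ω) (T : ℝ) {G : ℝ → ℝ}
    (hG : ContDiff ℝ (2 * p + 2 : ℕ) G) :
    ∃ M : ℝ, 0 ≤ M ∧ ∀ a δ : ℝ, 0 ≤ a → 0 ≤ δ → a + δ ≤ T → ∀ (q : ℝ[X]) (D : ℝ),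
      q.natDegree ≤ p → (∀ k ∈ Finset.range (p + 1), |q.coeff k| ≤ D) →
      |mulError x a δ G q| ≤ M * D * δ ^ (2 * p + 2) := by
  have hk : ∀ k : ℕ, ∃ M : ℝ, 0 ≤ M ∧ ∀ a δ : ℝ, 0 ≤ a → 0 ≤ δ → a + δ ≤ T →
      |mulError x a δ G (X ^ k)| ≤ M * δ ^ (2 * p + 2) := fun k => by
    obtain ⟨M, hM, h⟩ := exists_colloc_last_error_bound hx T
      (G := fun t => t ^ k * G t) ((contDiff_id.pow k).mul hG)
    refine ⟨M, hM, fun a δ ha hδ haT => ?_⟩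
    have hd : ∀ t, deriv (fun t => t ^ k * G t) t
        = (derivative (X ^ k : ℝ[X])).eval t * G t + (X ^ k : ℝ[X]).eval t * deriv G t := fun t => by
      have h1 := (Polynomial.hasDerivAt (X ^ k : ℝ[X]) t).mul
        (hG.differentiable (by positivity) t).hasDerivAt
      simp only [eval_pow, eval_X] at h1 ⊢
      exact h1.deriv
    have h2 := h a δ ha hδ haT
    simp only [hd] at h2
    simpa [mulError] using h2
  choose M hM h using hk
  refine ⟨∑ k ∈ Finset.range (p + 1), M k, Finset.sum_nonneg fun k _ => hM k,
    fun a δ ha hδ haT q D hq hD => ?_⟩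
  rw [q.as_sum_range' (p + 1) (Nat.lt_succ_iff.2 hq), map_sum, Finset.sum_mul, Finset.sum_mul]
  refine (Finset.abs_sum_le_sum_abs _ _).trans (Finset.sum_le_sum fun k hk => ?_)
  rw [← C_mul_X_pow_eq_monomial, ← smul_eq_C_mul, map_smul, smul_eq_mul, abs_mul]
  calc |q.coeff k| * |mulError x a δ G (X ^ k)| ≤ D * (M k * δ ^ (2 * p + 2)) :=
        mul_le_mul (hD k hk) (h k a δ ha hδ haT) (abs_nonneg _) ((abs_nonneg _).trans (hD k hk))
    _ = M k * D * δ ^ (2 * p + 2) := by ring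

/-! ### Errors of approximate solutions of the collocation equations -/

/-- `U` solves the collocation equations on `[a, a + δ]` with initial value `v` up to `ρ`. -/
def ResidualLE (f : ℝ → ℝ → ℝ) (x : Fin (p + 1) → ℝ) (a δ v ρ : ℝ) (U : Fin (p + 1) → ℝ) : Prop :=
  ∀ i, |U i - v - colloc x δ (fun j => f (node x a δ j) (U j)) i| ≤ ρ

theorem node_mem_of_le (hx : IsRightGaussRadau p x ω) {a δ T : ℝ} (ha : 0 ≤ a) (hδ : 0 ≤ δ)
    (haT : a + δ ≤ T) (i : Fin (p + 1)) : node x a δ i ∈ Set.Icc 0 T :=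
  Set.Icc_subset_Icc ha haT (node_mem hx a hδ i)

/-- The nodal error is controlled by the residual, and conversely. -/
theorem exists_node_error_and_residual_bounds (hx : IsRightGaussRadau p x ω) {T : ℝ} {f : ℝ → ℝ → ℝ}
    (hf : ContDiff ℝ 1 (fun z : ℝ × ℝ => f z.1 z.2)) {u : ℝ → ℝ} (hu : ContDiff ℝ (p + 2 : ℕ) u)
    (hu' : ∀ s ∈ Set.Icc 0 T, HasDerivAt u (f s (u s)) s) {R : ℝ} (hR : 0 ≤ R) :
    ∃ C δ₀ : ℝ, 0 ≤ C ∧ 0 < δ₀ ∧ ∀ a δ : ℝ, 0 ≤ a → 0 < δ → δ ≤ δ₀ → a + δ ≤ T →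
      ∀ U, NodalClose u x a δ R U →
        (∀ ρ, 0 ≤ ρ → ResidualLE f x a δ (u a) ρ U →
          NodalClose u x a δ (C * (ρ + δ ^ (p + 2))) U) ∧
        ∀ r, 0 ≤ r → NodalClose u x a δ r U →
          ResidualLE f x a δ (u a) (C * (r + δ ^ (p + 2))) U := by
  obtain ⟨Λ, hΛ, hlip⟩ := exists_tube_lipschitz (T := T) hf hu.continuous R
  obtain ⟨M, hM, herr⟩ := exists_colloc_error_bound hx T hu
  set B := collocBound x
  have hB : 0 ≤ B := collocBound_nonneg x
  set δ₀ : ℝ := 1 / (2 * (B * Λ + 1)) with hδ₀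
  have hδ₀pos : 0 < δ₀ := by positivity
  have hδ₀' : δ₀ * (B * Λ) ≤ 1 / 2 := by
    rw [hδ₀, div_mul_eq_mul_div, div_le_iff₀ (by positivity)]
    linarith
  refine ⟨2 + 2 * M, δ₀, by positivity, hδ₀pos, fun a δ ha hδ hδle haT U hU => ?_⟩
  have hn := node_mem_of_le hx ha hδ.le haT
  have hderiv : ∀ j, deriv u (node x a δ j) = f (node x a δ j) (u (node x a δ j)) := fun j =>
    (hu' _ (hn j)).deriv
  have e1 := herr a δ ha hδ.le haT
  simp only [hderiv] at e1
  have hδB : B * δ * Λ ≤ 1 / 2 := by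
    refine le_trans (le_of_eq_of_le ?_ (mul_le_mul_of_nonneg_right hδle (by positivity))) hδ₀'
    ring
  -- Error plus residual equals the quadrature of `f(u) - f(U)` plus the quadrature error of `u`.
  -- The choice of `δ₀` makes the first at most `e / 2`, so either of error and residual bounds the
  -- other.
  have key : ∀ e, 0 ≤ e → (∀ j, |u (node x a δ j) - U j| ≤ e) → ∀ i,
      |(u (node x a δ i) - U i) + (U i - u a - colloc x δ (fun j => f (node x a δ j) (U j)) i)|
        ≤ e / 2 + M * δ ^ (p + 2) := by
    intro e he hUe i
    have e2 := abs_colloc_le (x := x) hδ.le (c := Λ * e) (by positivity)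
      (g := fun j => f (node x a δ j) (u (node x a δ j)) - f (node x a δ j) (U j))
      (fun j => (hlip _ (hn j) _ _ (by simpa using hR) (hU j)).trans
        (mul_le_mul_of_nonneg_left (hUe j) hΛ)) i
    rw [colloc_sub] at e2
    have e3 : B * δ * (Λ * e) ≤ e / 2 := by nlinarith
    have e4 : (u (node x a δ i) - U i)
          + (U i - u a - colloc x δ (fun j => f (node x a δ j) (U j)) i)
        = (colloc x δ (fun j => f (node x a δ j) (u (node x a δ j))) i
            - colloc x δ (fun j => f (node x a δ j) (U j)) i)
          + (u (node x a δ i) - u a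
            - colloc x δ (fun j => f (node x a δ j) (u (node x a δ j))) i) := by ring
    rw [e4]
    exact (abs_add_le _ _).trans (add_le_add (e2.trans e3) (e1 i))
  have hpow : 0 ≤ δ ^ (p + 2) := by positivity
  constructor
  · intro ρ hρ hres
    set E : Fin (p + 1) → ℝ := fun j => u (node x a δ j) - U j with hE
    have hEj : ∀ j, |E j| ≤ ‖E‖ := fun j => norm_le_pi_norm E j
    have hle : ‖E‖ ≤ ρ + (‖E‖ / 2 + M * δ ^ (p + 2)) := by
      refine (pi_norm_le_iff_of_nonneg (by positivity)).2 fun i => ?_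
      have h1 := key ‖E‖ (norm_nonneg _) hEj i
      have h2 := hres i
      rw [Real.norm_eq_abs]
      rw [abs_le] at h1 h2 ⊢
      simp only [hE] at h1 ⊢
      constructor <;> linarith [h1.1, h1.2, h2.1, h2.2]
    intro j
    have hMρ : 0 ≤ M * ρ := by positivity
    refine (hEj j).trans ?_
    nlinarith
  · intro r hr hUr i
    have h1 := key r hr hUr i
    have h2 := hUr i
    have hMr : 0 ≤ M * r := by positivity
    rw [abs_le] at h1 h2 ⊢
    constructor <;> nlinarith [h1.1, h1.2, h2.1, h2.2]

/-- Superconvergence at the right endpoint. -/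
theorem exists_endpoint_error_bound (hx : IsRightGaussRadau p x ω) {T : ℝ} {f : ℝ → ℝ → ℝ}
    (hp : 0 < p) (hf : ContDiff ℝ (2 * p + 1 : ℕ) (fun z : ℝ × ℝ => f z.1 z.2)) {u : ℝ → ℝ}
    (hu : ContDiff ℝ (2 * p + 2 : ℕ) u)
    (hu' : ∀ s ∈ Set.Icc 0 T, HasDerivAt u (f s (u s)) s) (R C₁ : ℝ) (hC₁ : 0 ≤ C₁) :
    ∃ C : ℝ, 0 ≤ C ∧ ∀ a δ : ℝ, 0 ≤ a → 0 < δ → δ ≤ 1 → a + δ ≤ T →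
      ∀ U, NodalClose u x a δ R U → ∀ ρ, 0 ≤ ρ → ρ ≤ 1 → ResidualLE f x a δ (u a) ρ U →
        NodalClose u x a δ (C₁ * (ρ + δ ^ (p + 2))) U →
        |u (a + δ) - U (Fin.last p)| ≤ C * (ρ + δ ^ (2 * p + 2)) := by
  set J : ℝ → ℝ := fun s => partialSnd f s (u s) with hJdef
  have hJ : ContDiff ℝ p J :=
    (contDiff_partialSnd (n := p) (hf.of_le (by exact_mod_cast (by omega)))).comp
      (contDiff_id.prodMk (hu.of_le (by exact_mod_cast (by omega))))
  obtain ⟨c, D, M, hc, hD, hM, hq⟩ := exists_adjoint_polynomial T hJ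
  obtain ⟨Λ, hΛ, hlin⟩ := exists_tube_linearization (T := T)
    (hf.of_le (by exact_mod_cast (by omega))) hu.continuous R
  obtain ⟨M₁, hM₁, hmul⟩ := exists_mulError_bound hx T hu
  obtain ⟨JB, hJB⟩ := (isCompact_Icc (a := (0 : ℝ)) (b := T)).exists_bound_of_continuousOn
    hJ.continuous.continuousOn
  set B := collocBound x
  have hB : 0 ≤ B := collocBound_nonneg x
  set H : ℝ := M * (C₁ + 1) + D * (2 * Λ * C₁ ^ 2 + |JB|) with hH
  have hH0 : 0 ≤ H := by positivity
  refine ⟨(M₁ * D + B * H) / c + 1, by positivity,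
    fun a δ ha hδ hδ1 haT U hU ρ hρ hρ1 hres hclose => ?_⟩
  have hn := node_mem_of_le hx ha hδ.le haT
  have hb : a + δ ∈ Set.Icc 0 T := ⟨by linarith, haT⟩
  obtain ⟨q, hqd, hqc, hqk, hqt⟩ := hq _ hb
  -- `W` has the slopes `f(t_j, U_j)` at the nodes and differs there from `U` exactly by the
  -- residual.
  obtain ⟨W, hWd, hWa, hW', hWn⟩ := exists_polynomial_derivative_eval_node hx a (u a) hδ
    (fun j => f (node x a δ j) (U j))
  set τ : ℝ := ρ + δ ^ (2 * p + 2) with hτ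
  have hτ0 : 0 ≤ τ := by positivity
  set σ : ℝ := ρ + δ ^ (p + 2) with hσ
  have hσ0 : 0 ≤ σ := by positivity
  have hρτ : ρ ≤ τ := by rw [hτ]; linarith [pow_pos hδ (2 * p + 2)]
  -- The adjoint defect, of order `p`, times the nodal error, of order `p + 2`, reaches the order
  -- `2p + 2`.
  have hδσ : δ ^ p * σ ≤ τ := by
    have h1 : δ ^ p ≤ 1 := pow_le_one₀ hδ.le hδ1
    have h2 : δ ^ p * δ ^ (p + 2) = δ ^ (2 * p + 2) := by rw [← pow_add]; congr 1; ring
    rw [hσ, hτ, mul_add, h2]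
    nlinarith
  have hσσ : σ ^ 2 ≤ 2 * τ := by
    have h1 : (δ ^ (p + 2)) ^ 2 ≤ δ ^ (2 * p + 2) := by
      rw [← pow_mul]
      exact pow_le_pow_of_le_one hδ.le hδ1 (by omega)
    have h2 : ρ ^ 2 ≤ ρ := by nlinarith
    have h3 : σ ^ 2 ≤ 2 * (ρ ^ 2 + (δ ^ (p + 2)) ^ 2) := by
      rw [hσ]
      nlinarith [sq_nonneg (ρ - δ ^ (p + 2))]
    rw [hτ]
    linarith
  have hρσ : ρ ≤ σ := by rw [hσ]; linarith [pow_pos hδ (p + 2)]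
  have hUW : ∀ j, |U j - W.eval (node x a δ j)| ≤ ρ := fun j => by
    rw [hWn]
    have h := hres j
    rwa [sub_sub] at h
  have hWu : ∀ j, |W.eval (node x a δ j) - u (node x a δ j)| ≤ (C₁ + 1) * σ := fun j => by
    have h1 := hUW j
    have h2 := hclose j
    rw [abs_le] at h1 h2 ⊢
    constructor <;> nlinarith [h1.1, h1.2, h2.1, h2.2]
  -- The derivative of `q (W - u)` at the nodes. Linearizing `f` along `u` splits it into `(q' + J
  -- q)(W - u)`, a quadratic remainder in `U - u`, and `J (U - W)`; they are controlled by `δ^p σ`,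
  -- `σ^2` and `ρ` respectively, all `O(τ)`.
  set g : Fin (p + 1) → ℝ := fun j =>
    (derivative q).eval (node x a δ j) * (W.eval (node x a δ j) - u (node x a δ j))
      + q.eval (node x a δ j)
        * (f (node x a δ j) (U j) - f (node x a δ j) (u (node x a δ j))) with hg
  have hgle : ∀ j, |g j| ≤ H * τ := fun j => by
    set t := node x a δ j with ht
    obtain ⟨h1, h2⟩ := hqt t (hn j)
    have h3 : |t - (a + δ)| ^ p ≤ δ ^ p := by
      refine pow_le_pow_left₀ (abs_nonneg _) ?_ _
      have := node_mem hx a hδ.le j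
      rw [abs_le]
      constructor <;> linarith [this.1, this.2]
    have h4 := hlin t (hn j) (U j) (hU j)
    have h5 : |U j - u t| ^ 2 ≤ C₁ ^ 2 * (2 * τ) := by
      have h := hclose j
      rw [abs_sub_comm] at h
      calc |U j - u t| ^ 2 ≤ (C₁ * σ) ^ 2 := pow_le_pow_left₀ (abs_nonneg _) h 2
        _ = C₁ ^ 2 * σ ^ 2 := by ring
        _ ≤ C₁ ^ 2 * (2 * τ) := by gcongr
    have h6 : |J t * (U j - W.eval t)| ≤ |JB| * τ := by
      rw [abs_mul]
      exact mul_le_mul ((hJB t (hn j)).trans (le_abs_self _)) ((hUW j).trans hρτ)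
        (abs_nonneg _) (abs_nonneg _)
    have h7 : g j = ((derivative q).eval t + J t * q.eval t) * (W.eval t - u t)
        + q.eval t * ((f t (U j) - f t (u t) - J t * (U j - u t)) + J t * (U j - W.eval t)) := by
      simp only [hg, ← ht]
      ring
    have h8 : |((derivative q).eval t + J t * q.eval t) * (W.eval t - u t)|
        ≤ M * (C₁ + 1) * τ := by
      rw [abs_mul]
      calc _ ≤ (M * δ ^ p) * ((C₁ + 1) * σ) :=
            mul_le_mul (h2.trans (mul_le_mul_of_nonneg_left h3 hM)) (hWu j) (abs_nonneg _)
              (by positivity)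
        _ = M * (C₁ + 1) * (δ ^ p * σ) := by ring
        _ ≤ M * (C₁ + 1) * τ := by gcongr
    have h9 : |q.eval t * ((f t (U j) - f t (u t) - J t * (U j - u t))
        + J t * (U j - W.eval t))| ≤ D * (Λ * (C₁ ^ 2 * (2 * τ)) + |JB| * τ) := by
      rw [abs_mul]
      refine mul_le_mul h1 ?_ (abs_nonneg _) hD
      exact (abs_add_le _ _).trans
        (add_le_add (h4.trans (mul_le_mul_of_nonneg_left h5 hΛ)) h6)
    rw [h7]
    refine (abs_add_le _ _).trans ((add_le_add h8 h9).trans (le_of_eq ?_))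
    rw [hH]
    ring
  have e1 := abs_colloc_le (x := x) hδ.le (by positivity) hgle (Fin.last p)
  have e2 := hmul a δ ha hδ.le haT q D hqd hqk
  have e3 := eval_add_sub_eval_eq_colloc hx a δ (P := q * W)
    (natDegree_mul_le.trans (by omega))
  simp only [derivative_mul, eval_mul, eval_add, hW', hWa] at e3
  have hderiv : ∀ j, deriv u (node x a δ j) = f (node x a δ j) (u (node x a δ j)) := fun j =>
    (hu' _ (hn j)).deriv
  simp only [mulError, LinearMap.coe_mk, AddHom.coe_mk, hderiv] at e2
  -- The term at `a` drops out because `W(a) = u(a)`; the bracket is the quadrature error of `q u`.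
  have e4 : q.eval (a + δ) * (W.eval (a + δ) - u (a + δ))
      = colloc x δ g (Fin.last p)
        - (q.eval (a + δ) * u (a + δ) - q.eval a * u a
          - colloc x δ (fun j => (derivative q).eval (node x a δ j) * u (node x a δ j)
            + q.eval (node x a δ j) * f (node x a δ j) (u (node x a δ j))) (Fin.last p)) := by
    have h : g = fun j => ((derivative q).eval (node x a δ j) * W.eval (node x a δ j)
          + q.eval (node x a δ j) * f (node x a δ j) (U j))
        - ((derivative q).eval (node x a δ j) * u (node x a δ j)
          + q.eval (node x a δ j) * f (node x a δ j) (u (node x a δ j))) := by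
      funext j
      simp only [hg]
      ring
    rw [h, colloc_sub]
    linarith
  have e5 : c * |W.eval (a + δ) - u (a + δ)| ≤ (M₁ * D + B * H) * τ := by
    calc c * |W.eval (a + δ) - u (a + δ)|
        ≤ |q.eval (a + δ)| * |W.eval (a + δ) - u (a + δ)| :=
          mul_le_mul_of_nonneg_right (hqc.trans (le_abs_self _)) (abs_nonneg _)
      _ = |q.eval (a + δ) * (W.eval (a + δ) - u (a + δ))| := (abs_mul _ _).symm
      _ ≤ B * δ * (H * τ) + M₁ * D * δ ^ (2 * p + 2) := by
          rw [e4]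
          exact (abs_sub _ _).trans (add_le_add e1 e2)
      _ ≤ B * 1 * (H * τ) + M₁ * D * τ := by
          have : δ ^ (2 * p + 2) ≤ τ := by rw [hτ]; linarith
          gcongr
      _ = (M₁ * D + B * H) * τ := by ring
  have e6 := hUW (Fin.last p)
  rw [node_last hx] at e6
  have e7 : |W.eval (a + δ) - u (a + δ)| ≤ (M₁ * D + B * H) / c * τ := by
    rw [div_mul_eq_mul_div, le_div_iff₀ hc]
    linarith
  rw [abs_le] at e6 e7 ⊢
  constructor <;> linarith [e6.1, e6.2, e7.1, e7.2]

/-- Approximate solutions of the collocation equations satisfy the error bounds, in terms of their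
residual. -/
theorem exists_residual_bounds (hx : IsRightGaussRadau p x ω) {T : ℝ} {f : ℝ → ℝ → ℝ}
    (hf : ContDiff ℝ (2 * p + 1 : ℕ) (fun z : ℝ × ℝ => f z.1 z.2)) {u : ℝ → ℝ}
    (hu : ContDiff ℝ (2 * p + 2 : ℕ) u)
    (hu' : ∀ s ∈ Set.Icc 0 T, HasDerivAt u (f s (u s)) s) {R : ℝ} (hR : 0 ≤ R) :
    ∃ C δ₀ : ℝ, 0 ≤ C ∧ 0 < δ₀ ∧ ∀ a δ : ℝ, 0 ≤ a → 0 < δ → δ ≤ δ₀ → a + δ ≤ T →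
      ∀ U, NodalClose u x a δ R U →
        (∀ ρ, 0 ≤ ρ → ρ ≤ 1 → ResidualLE f x a δ (u a) ρ U →
          NodalClose u x a δ (C * (ρ + δ ^ (p + 2))) U ∧
          |u (a + δ) - U (Fin.last p)| ≤ C * (ρ + δ ^ (2 * p + 2))) ∧
        ∀ r, 0 ≤ r → NodalClose u x a δ r U →
          ResidualLE f x a δ (u a) (C * (r + δ ^ (p + 2))) U := by
  obtain ⟨C₁, δ₁, hC₁, hδ₁, h₁⟩ := exists_node_error_and_residual_bounds hx (T := T)
    (hf.of_le (by exact_mod_cast (by omega))) (hu.of_le (by exact_mod_cast (by omega))) hu' hR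
  -- For `p = 0` the function `f` need not be `C^2`, so it cannot be linearized; but then the
  -- endpoint is the only node and both orders equal `2`.
  rcases Nat.eq_zero_or_pos p with rfl | hp
  · refine ⟨C₁, δ₁, hC₁, hδ₁, fun a δ ha hδ hδle haT U hU => ?_⟩
    obtain ⟨h2, h3⟩ := h₁ a δ ha hδ hδle haT U hU
    refine ⟨fun ρ hρ _ hres => ⟨h2 ρ hρ hres, ?_⟩, h3⟩
    have h := h2 ρ hρ hres (Fin.last 0)
    rwa [node_last hx] at h
  · obtain ⟨C₂, hC₂, h₂⟩ := exists_endpoint_error_bound hx hp hf hu hu' R C₁ hC₁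
    refine ⟨C₁ + C₂, min δ₁ 1, by positivity, by positivity, fun a δ ha hδ hδle haT U hU => ?_⟩
    obtain ⟨h2, h3⟩ := h₁ a δ ha hδ (hδle.trans (min_le_left _ _)) haT U hU
    refine ⟨fun ρ hρ hρ1 hres => ⟨fun j => (h2 ρ hρ hres j).trans ?_,
      (h₂ a δ ha hδ (hδle.trans (min_le_right _ _)) haT U hU ρ hρ hρ1 hres
        (h2 ρ hρ hres)).trans ?_⟩, fun r hr hUr j => (h3 r hr hUr j).trans ?_⟩
    all_goals
      refine mul_le_mul_of_nonneg_right ?_ (by positivity)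
      linarith

/-! ### The steps of the schemes -/

theorem IsRightGaussRadau.weight_le_two (hx : IsRightGaussRadau p x ω) (i : Fin (p + 1)) :
    ω i ≤ 2 := by
  have h := hx.exact 1 (by simp)
  simp only [eval_one, mul_one, integral_one] at h
  have h' := Finset.single_le_sum (fun j _ => hx.weight_nonneg j) (Finset.mem_univ i)
  linarith

theorem abs_half_mul_weight_mul_le (hx : IsRightGaussRadau p x ω) {δ y c : ℝ} (hδ : 0 ≤ δ)
    (hy : |y| ≤ c) (i : Fin (p + 1)) : |δ / 2 * ω i * y| ≤ δ * c := by
  have h1 := hx.weight_le_two i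
  have h2 := hx.weight_nonneg i
  rw [abs_mul, abs_of_nonneg (by positivity)]
  exact mul_le_mul (by nlinarith) hy (abs_nonneg _) hδ

theorem sweep_zero (hx : IsRightGaussRadau p x ω) (f : ℝ → ℝ → ℝ) (a δ : ℝ)
    (U : Fin (p + 1) → ℝ) :
    sweep f x ω a δ U 0 = colloc x δ (fun j => f (node x a δ j) (U j)) 0 := by
  simp only [sweep, colloc, hx.tildeL_zero_mul_weight]

theorem sweep_succ (hx : IsRightGaussRadau p x ω) (f : ℝ → ℝ → ℝ) (a δ : ℝ)
    (U : Fin (p + 1) → ℝ) (m : Fin p) :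
    sweep f x ω a δ U m.succ = colloc x δ (fun j => f (node x a δ j) (U j)) m.succ
      - colloc x δ (fun j => f (node x a δ j) (U j)) m.castSucc := by
  simp only [sweep, colloc, hx.tildeL_succ_mul_weight, sub_mul, Finset.sum_sub_distrib, mul_sub]

theorem abs_sweep_le (hx : IsRightGaussRadau p x ω) {f : ℝ → ℝ → ℝ} {a δ F : ℝ} (hδ : 0 ≤ δ)
    (hF : 0 ≤ F) {U : Fin (p + 1) → ℝ} (hU : ∀ j, |f (node x a δ j) (U j)| ≤ F)
    (i : Fin (p + 1)) : |sweep f x ω a δ U i| ≤ 2 * collocBound x * δ * F := by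
  have h := abs_colloc_le (x := x) hδ hF hU
  have hB := collocBound_nonneg x
  have h0 : 0 ≤ collocBound x * δ * F := by positivity
  refine Fin.cases ?_ (fun m => ?_) i
  · rw [sweep_zero hx]
    linarith [h 0]
  · rw [sweep_succ hx]
    refine (abs_sub _ _).trans ?_
    linarith [h m.succ, h m.castSucc]

theorem abs_le_of_increments {D : Fin (p + 1) → ℝ} {β : ℝ} (h0 : |D 0| ≤ β)
    (hs : ∀ m : Fin p, |D m.succ - D m.castSucc| ≤ β) (i : Fin (p + 1)) :
    |D i| ≤ (p + 1) * β := by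
  have hβ : 0 ≤ β := (abs_nonneg _).trans h0
  have key : ∀ i : Fin (p + 1), |D i| ≤ ((i : ℕ) + 1) * β := fun i => by
    induction i using Fin.induction with
    | zero => simpa using h0
    | succ m ih =>
      have h1 := hs m
      have h2 : |D m.succ| ≤ |D m.succ - D m.castSucc| + |D m.castSucc| := by
        simpa using abs_add_le (D m.succ - D m.castSucc) (D m.castSucc)
      simp only [Fin.val_castSucc] at ih
      simp only [Fin.val_succ]
      push_cast
      linarith
  refine (key i).trans (mul_le_mul_of_nonneg_right ?_ hβ)
  have : (i : ℕ) ≤ p := Nat.lt_succ_iff.1 i.2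
  have : ((i : ℕ) : ℝ) ≤ p := by exact_mod_cast this
  linarith

/-- A step of either scheme differs from the Picard step of the collocation equations by at most a
multiple of the length of the interval and of the size of the correction. -/
theorem abs_step_sub_colloc_le (hx : IsRightGaussRadau p x ω) {f : ℝ → ℝ → ℝ} {a δ v Λ : ℝ}
    (hδ : 0 ≤ δ) (hΛ : 0 ≤ Λ) {U V : Fin (p + 1) → ℝ}
    (hlip : ∀ j, |f (node x a δ j) (V j) - f (node x a δ j) (U j)| ≤ Λ * |V j - U j|)
    (hV : IsExplicitStep f x ω a δ v U V ∨ IsImplicitStep f x ω a δ v U V) (i : Fin (p + 1)) :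
    |V i - v - colloc x δ (fun j => f (node x a δ j) (U j)) i|
      ≤ (p + 1) * (δ * (Λ * ‖V - U‖)) := by
  have hw : ∀ j, |δ / 2 * ω j * (f (node x a δ j) (V j) - f (node x a δ j) (U j))|
      ≤ δ * (Λ * ‖V - U‖) := fun j =>
    abs_half_mul_weight_mul_le hx hδ
      ((hlip j).trans (mul_le_mul_of_nonneg_left (norm_le_pi_norm (V - U) j) hΛ)) j
  -- In the increments of this difference the sweeps cancel and only one correction `ω (f(V) -
  -- f(U))` remains: at the left node for the explicit scheme (none in its first row), at the right
  -- node for the implicit one.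
  refine abs_le_of_increments
    (D := fun i => V i - v - colloc x δ (fun j => f (node x a δ j) (U j)) i) ?_ (fun m => ?_) i
  · rcases hV with hV | hV
    · rw [hV.zero, sweep_zero hx]
      have : 0 ≤ δ * (Λ * ‖V - U‖) := by positivity
      simpa using this
    · rw [hV.zero, sweep_zero hx]
      convert hw 0 using 2
      ring
  · rcases hV with hV | hV
    · rw [hV.succ, sweep_succ hx]
      convert hw m.castSucc using 2
      ring
    · rw [hV.succ, sweep_succ hx]
      convert hw m.succ using 2
      ring

/-- Let `P` be the Picard step from `U`. Then `V - P` is at most `‖V - U‖ / 2` and `P - U` is the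
residual of `U` up to sign, whence `‖V - U‖ ≤ 2ρ`. The residual of `V` is `V - P` minus the
quadrature of `f(V) - f(U)`, and both are `O(δ ‖V - U‖)`. -/
theorem ResidualLE.of_step {f : ℝ → ℝ → ℝ} {a δ v Λ ρ : ℝ} (hx : IsRightGaussRadau p x ω)
    (hδ : 0 ≤ δ) (hΛ : 0 ≤ Λ) (hρ : 0 ≤ ρ) {U V : Fin (p + 1) → ℝ}
    (hlip : ∀ j, |f (node x a δ j) (V j) - f (node x a δ j) (U j)| ≤ Λ * |V j - U j|)
    (hV : IsExplicitStep f x ω a δ v U V ∨ IsImplicitStep f x ω a δ v U V)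
    (hsmall : (p + 1) * Λ * δ ≤ 1 / 2) (hU : ResidualLE f x a δ v ρ U) :
    ResidualLE f x a δ v (2 * (p + 1 + collocBound x) * Λ * δ * ρ) V := by
  have hs := abs_step_sub_colloc_le hx hδ hΛ hlip hV
  set e := ‖V - U‖ with he
  have he0 : 0 ≤ e := norm_nonneg _
  have hB := collocBound_nonneg x
  have h1 : (p + 1) * (δ * (Λ * e)) ≤ e / 2 := by
    calc (p + 1) * (δ * (Λ * e)) = ((p + 1) * Λ * δ) * e := by ring
      _ ≤ 1 / 2 * e := mul_le_mul_of_nonneg_right hsmall he0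
      _ = e / 2 := by ring
  have h2 : e ≤ e / 2 + ρ := by
    refine (pi_norm_le_iff_of_nonneg (by positivity)).2 fun i => ?_
    have h3 := hs i
    have h4 := hU i
    rw [Real.norm_eq_abs, Pi.sub_apply]
    rw [abs_le] at h3 h4 ⊢
    constructor <;> linarith [h3.1, h3.2, h4.1, h4.2]
  intro i
  have h5 := abs_colloc_le (x := x) hδ (c := Λ * e) (by positivity)
    (g := fun j => f (node x a δ j) (V j) - f (node x a δ j) (U j))
    (fun j => (hlip j).trans (mul_le_mul_of_nonneg_left (norm_le_pi_norm (V - U) j) hΛ)) i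
  rw [colloc_sub] at h5
  have h6 := hs i
  have h7 : ((p + 1) + collocBound x) * Λ * δ * e ≤ ((p + 1) + collocBound x) * Λ * δ * (2 * ρ) :=
    mul_le_mul_of_nonneg_left (by linarith) (by positivity)
  have h8 := abs_sub (V i - v - colloc x δ (fun j => f (node x a δ j) (U j)) i)
    (colloc x δ (fun j => f (node x a δ j) (V j)) i
      - colloc x δ (fun j => f (node x a δ j) (U j)) i)
  rw [sub_sub_sub_cancel_right] at h8
  nlinarith

/-- The error bounds for iterates that stay near the exact solution. -/
theorem exists_iteration_error_bounds (hx : IsRightGaussRadau p x ω) {T : ℝ} {f : ℝ → ℝ → ℝ}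
    (hf : ContDiff ℝ (2 * p + 1 : ℕ) (fun z : ℝ × ℝ => f z.1 z.2)) {u : ℝ → ℝ}
    (hu : ContDiff ℝ (2 * p + 2 : ℕ) u)
    (hu' : ∀ s ∈ Set.Icc 0 T, HasDerivAt u (f s (u s)) s) {R C₀ : ℝ} (hR : 0 ≤ R) (hC₀ : 0 ≤ C₀)
    (K : ℕ) :
    ∃ C h₀ : ℝ, 0 < h₀ ∧ ∀ a δ h : ℝ, 0 ≤ a → 0 < δ → δ ≤ h → h ≤ h₀ → a + δ ≤ T →
      ∀ U : Fin (K + 1) → Fin (p + 1) → ℝ, (∀ k, NodalClose u x a δ R (U k)) →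
        NodalClose u x a δ (C₀ * h ^ 2) (U 0) →
        (∀ k : Fin K, IsExplicitStep f x ω a δ (u a) (U k.castSucc) (U k.succ) ∨
          IsImplicitStep f x ω a δ (u a) (U k.castSucc) (U k.succ)) →
        ErrorBounds K u x a δ C h (U (Fin.last K)) := by
  obtain ⟨C₁, δ₁, hC₁, hδ₁, hres⟩ := exists_residual_bounds hx hf hu hu' hR
  obtain ⟨Λ, hΛ, hlip⟩ := exists_tube_lipschitz (T := T)
    (hf.of_le (by exact_mod_cast (by omega))) hu.continuous R
  set κ : ℝ := 2 * (p + 1 + collocBound x) * Λ with hκ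
  have hκ0 : 0 ≤ κ := by have := collocBound_nonneg x; positivity
  set Q : ℝ := κ ^ K * (C₁ * (C₀ + 1)) with hQ
  have hQ0 : 0 ≤ Q := by positivity
  -- The third bound on `h` makes the corrections contractive; the fourth keeps the final residual
  -- below `1`, as the endpoint estimate requires.
  refine ⟨C₁ * (Q + 1), min (min δ₁ 1) (min (1 / (2 * ((p + 1) * Λ + 1))) (1 / (Q + 1))),
    by positivity, fun a δ h ha hδ hδh hh haT U hU hU0 hstep => ?_⟩
  have hh1 : h ≤ 1 := hh.trans ((min_le_left _ _).trans (min_le_right _ _))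
  have hhδ₁ : h ≤ δ₁ := hh.trans ((min_le_left _ _).trans (min_le_left _ _))
  have hhΛ : h ≤ 1 / (2 * ((p + 1) * Λ + 1)) :=
    hh.trans ((min_le_right _ _).trans (min_le_left _ _))
  have hhQ : h ≤ 1 / (Q + 1) := hh.trans ((min_le_right _ _).trans (min_le_right _ _))
  have hh0 : 0 < h := hδ.trans_le hδh
  rw [le_div_iff₀ (by positivity)] at hhΛ hhQ
  have hpow : ∀ k, δ ^ (k + 2) ≤ h ^ (k + 2) := fun k => pow_le_pow_left₀ hδ.le hδh _
  have hsmall : (p + 1) * Λ * δ ≤ 1 / 2 := by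
    have : (p + 1) * Λ * δ ≤ (p + 1) * Λ * h := by gcongr
    nlinarith
  set ρ₀ : ℝ := C₁ * (C₀ + 1) * h ^ 2 with hρ₀
  have hρ₀0 : 0 ≤ ρ₀ := by positivity
  have hmono : ∀ {r s : ℝ} {V}, r ≤ s → ResidualLE f x a δ (u a) r V →
      ResidualLE f x a δ (u a) s V := fun hrs hV i => (hV i).trans hrs
  have hn := node_mem_of_le hx ha hδ.le haT
  have hres0 : ResidualLE f x a δ (u a) ρ₀ (U 0) := by
    refine hmono ?_
      ((hres a δ ha hδ (hδh.trans hhδ₁) haT _ (hU 0)).2 (C₀ * h ^ 2) (by positivity) hU0)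
    have h1 : δ ^ (p + 2) ≤ h ^ 2 := (hpow p).trans (pow_le_pow_of_le_one hh0.le hh1 (by omega))
    calc C₁ * (C₀ * h ^ 2 + δ ^ (p + 2)) ≤ C₁ * (C₀ * h ^ 2 + h ^ 2) := by gcongr
      _ = ρ₀ := by rw [hρ₀]; ring
  have hresk : ∀ k : Fin (K + 1),
      ResidualLE f x a δ (u a) ((κ * δ) ^ (k : ℕ) * ρ₀) (U k) := fun k => by
    induction k using Fin.induction with
    | zero => simpa using hres0
    | succ m ih =>
      have h1 := ResidualLE.of_step hx hδ.le hΛ (by positivity)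
        (fun j => hlip _ (hn j) _ _ (hU m.succ j) (hU m.castSucc j)) (hstep m) hsmall ih
      refine hmono (le_of_eq ?_) h1
      rw [hκ]
      simp only [Fin.val_castSucc, Fin.val_succ, pow_succ]
      ring
  have hresK : ResidualLE f x a δ (u a) (Q * h ^ (K + 2)) (U (Fin.last K)) := by
    refine hmono ?_ (hresk (Fin.last K))
    rw [Fin.val_last, mul_pow, hρ₀]
    calc κ ^ K * δ ^ K * (C₁ * (C₀ + 1) * h ^ 2) ≤ κ ^ K * h ^ K * (C₁ * (C₀ + 1) * h ^ 2) := by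
          gcongr
      _ = Q * h ^ (K + 2) := by rw [hQ, pow_add]; ring
  have hρ1 : Q * h ^ (K + 2) ≤ 1 := by
    have h1 : h ^ (K + 2) ≤ h := by
      simpa using pow_le_pow_of_le_one hh0.le hh1 (show 1 ≤ K + 2 by omega)
    have h2 : Q * h ^ (K + 2) ≤ Q * h := by gcongr
    nlinarith
  obtain ⟨e1, e2⟩ := (hres a δ ha hδ (hδh.trans hhδ₁) haT _ (hU (Fin.last K))).1 _
    (by positivity) hρ1 hresK
  have hmin : ∀ k, C₁ * (Q * h ^ (K + 2) + δ ^ (k + 2))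
      ≤ C₁ * (Q + 1) * h ^ min (k + 2) (K + 2) := fun k => by
    have h1 : h ^ (K + 2) ≤ h ^ min (k + 2) (K + 2) :=
      pow_le_pow_of_le_one hh0.le hh1 (min_le_right _ _)
    have h2 : δ ^ (k + 2) ≤ h ^ min (k + 2) (K + 2) :=
      (hpow k).trans (pow_le_pow_of_le_one hh0.le hh1 (min_le_left _ _))
    calc C₁ * (Q * h ^ (K + 2) + δ ^ (k + 2))
        ≤ C₁ * (Q * h ^ min (k + 2) (K + 2) + h ^ min (k + 2) (K + 2)) := by gcongr
      _ = _ := by ring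
  exact ⟨fun m => (e1 m.castSucc).trans (hmin p), e2.trans (hmin (2 * p))⟩

/-! ### The Euler methods -/

theorem exists_increment_bound (T : ℝ) {u : ℝ → ℝ} (hu : ContDiff ℝ 1 u) :
    ∃ L : ℝ, 0 ≤ L ∧ ∀ s ∈ Set.Icc 0 T, ∀ t ∈ Set.Icc 0 T, |u t - u s| ≤ L * |t - s| := by
  obtain ⟨L, hL, h⟩ := exists_taylorPoly_bound T 1 (G := u) (by exact_mod_cast hu)
  refine ⟨L, hL, fun s hs t ht => ?_⟩
  simpa [taylorPoly] using h s hs t ht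

/-- No order of `s` and `t` is assumed: explicit Euler expands at the old point, implicit Euler at
the new one, looking back. -/
theorem exists_euler_defect_bound {T : ℝ} {f : ℝ → ℝ → ℝ} {u : ℝ → ℝ} (hu : ContDiff ℝ 2 u)
    (hu' : ∀ s ∈ Set.Icc 0 T, HasDerivAt u (f s (u s)) s) :
    ∃ M : ℝ, 0 ≤ M ∧ ∀ s ∈ Set.Icc 0 T, ∀ t ∈ Set.Icc 0 T,
      |u t - u s - (t - s) * f s (u s)| ≤ M * |t - s| ^ 2 := by
  obtain ⟨M, hM, h⟩ := exists_taylorPoly_bound T 2 (G := u) (by exact_mod_cast hu)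
  refine ⟨M, hM, fun s hs t ht => ?_⟩
  convert h s hs t ht using 2
  simp [taylorPoly, Finset.sum_range_succ, (hu' s hs).deriv]
  ring

/-- A discrete Gronwall argument whose recursion holds only while the error is at most `r`; the
final bound, being at most `r`, justifies every use. The growth rests on `2 * 3^k + 1 ≤ 3^(k+1)` for
`k ≥ 1`. -/
theorem le_of_geometric_increments {E : Fin (p + 1) → ℝ} {β r : ℝ} (hβ : 0 ≤ β)
    (hr : 3 ^ (p + 1) * β ≤ r) (h0 : E 0 ≤ β)
    (hs : ∀ m : Fin p, E m.castSucc ≤ r → E m.succ ≤ 2 * E m.castSucc + β) (i : Fin (p + 1)) :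
    E i ≤ 3 ^ (p + 1) * β := by
  have hpow : ∀ i : Fin (p + 1), (3 : ℝ) ^ ((i : ℕ) + 1) * β ≤ 3 ^ (p + 1) * β := fun i =>
    mul_le_mul_of_nonneg_right (pow_le_pow_right₀ (by norm_num) (by omega)) hβ
  have key : ∀ i : Fin (p + 1), E i ≤ 3 ^ ((i : ℕ) + 1) * β := fun i => by
    induction i using Fin.induction with
    | zero =>
      simp only [Fin.val_zero, zero_add, pow_one]
      linarith
    | succ m ih =>
      have h1 := hs m (ih.trans ((hpow _).trans hr))
      have h2 : (1 : ℝ) ≤ 3 ^ ((m : ℕ) + 1) := one_le_pow₀ (by norm_num)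
      simp only [Fin.val_castSucc] at ih
      simp only [Fin.val_succ]
      rw [pow_succ]
      nlinarith
  exact (key i).trans (hpow i)

theorem node_sub_mem (hx : IsRightGaussRadau p x ω) (a : ℝ) {δ : ℝ} (hδ : 0 ≤ δ) (m : Fin p) :
    node x a δ m.succ - node x a δ m.castSucc ∈ Set.Icc 0 δ := by
  have h1 := hx.strictMono (Fin.castSucc_lt_succ (i := m))
  have h2 := (hx.mem_Icc m.succ).2
  have h3 := (hx.mem_Icc m.castSucc).1
  constructor <;> simp only [node] <;> nlinarith

theorem exists_euler_error_bound (hx : IsRightGaussRadau p x ω) {T : ℝ} {f : ℝ → ℝ → ℝ}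
    (hf : ContDiff ℝ 1 (fun z : ℝ × ℝ => f z.1 z.2)) {u : ℝ → ℝ} (hu : ContDiff ℝ 2 u)
    (hu' : ∀ s ∈ Set.Icc 0 T, HasDerivAt u (f s (u s)) s) {R : ℝ} (hR : 0 < R) :
    ∃ C δ₀ : ℝ, 0 ≤ C ∧ 0 < δ₀ ∧ ∀ a δ : ℝ, 0 ≤ a → 0 < δ → δ ≤ δ₀ → a + δ ≤ T → ∀ V,
      (IsExplicitEuler f x a δ (u a) V ∨
        IsImplicitEuler f x a δ (u a) V ∧ NodalClose u x a δ R V) →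
      NodalClose u x a δ (C * δ ^ 2) V := by
  obtain ⟨Λ, hΛ, hlip⟩ := exists_tube_lipschitz (T := T) hf hu.continuous R
  obtain ⟨M, hM, hdef⟩ := exists_euler_defect_bound hu hu'
  refine ⟨3 ^ (p + 1) * (2 * M), min (min 1 (1 / (2 * (Λ + 1)))) (R / (3 ^ (p + 1) * (2 * M) + 1)),
    by positivity, by positivity, fun a δ ha hδ hδle haT V hV => ?_⟩
  have hδ1 : δ ≤ 1 := hδle.trans ((min_le_left _ _).trans (min_le_left _ _))
  have hδΛ : δ ≤ 1 / (2 * (Λ + 1)) := hδle.trans ((min_le_left _ _).trans (min_le_right _ _))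
  have hδR : δ ≤ R / (3 ^ (p + 1) * (2 * M) + 1) := hδle.trans (min_le_right _ _)
  rw [le_div_iff₀ (by positivity)] at hδΛ hδR
  have hn := node_mem_of_le hx ha hδ.le haT
  have haI : a ∈ Set.Icc 0 T := ⟨ha, by linarith⟩
  have hδδ : δ ^ 2 ≤ δ := by nlinarith
  have hr : 3 ^ (p + 1) * (2 * M * δ ^ 2) ≤ R := by
    have : 3 ^ (p + 1) * (2 * M) * δ ^ 2 ≤ 3 ^ (p + 1) * (2 * M) * δ := by gcongr
    nlinarith
  have hdef' : ∀ s ∈ Set.Icc 0 T, ∀ t ∈ Set.Icc 0 T, |t - s| ≤ δ →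
      |u t - u s - (t - s) * f s (u s)| ≤ M * δ ^ 2 := fun s hs t ht hst =>
    (hdef s hs t ht).trans
      (mul_le_mul_of_nonneg_left (pow_le_pow_left₀ (abs_nonneg _) hst 2) hM)
  have hMδ : 0 ≤ M * δ ^ 2 := by positivity
  have hΔ : ∀ m : Fin p, |node x a δ m.succ - node x a δ m.castSucc| ≤ δ := fun m => by
    obtain ⟨h1, h2⟩ := node_sub_mem hx a hδ.le m
    rwa [abs_of_nonneg h1]
  have hΔ0 : |node x a δ 0 - a| ≤ δ := by
    obtain ⟨h1, h2⟩ := node_mem hx a hδ.le 0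
    rw [abs_le]
    constructor <;> linarith
  have hmul : ∀ {d y e : ℝ}, |d| ≤ δ → |y| ≤ Λ * |e| → |d * y| ≤ |e| / 2 := fun {d y e} hd hy => by
    rw [abs_mul]
    have h1 : |d| * |y| ≤ δ * (Λ * |e|) := mul_le_mul hd hy (abs_nonneg _) hδ.le
    have h2 : δ * Λ ≤ 1 / 2 := by nlinarith
    have h3 : δ * Λ * |e| ≤ 1 / 2 * |e| := mul_le_mul_of_nonneg_right h2 (abs_nonneg _)
    linarith
  intro i
  rw [mul_assoc]
  -- In the implicit case `E' ≤ E + E' / 2 + M δ^2`, which gives the factor `2` and `β = 2 M δ^2`;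
  -- the explicit recursion is weaker than that. Explicit values enter the tube through the
  -- condition `E ≤ r = R`.
  refine le_of_geometric_increments (E := fun i => |u (node x a δ i) - V i|)
    (r := R) (by positivity) hr ?_ (fun m hm => ?_) i
  · rcases hV with hV | ⟨hV, hVR⟩
    · have h1 := hdef' a haI _ (hn 0) hΔ0
      rw [hV.zero, ← sub_sub]
      linarith
    · have h1 := hdef' _ (hn 0) a haI (by rwa [abs_sub_comm])
      have h2 := hmul hΔ0 (hlip _ (hn 0) (u (node x a δ 0)) _ (by simpa using hR.le) (hVR 0))
      have h3 : u (node x a δ 0) - V 0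
          = (node x a δ 0 - a) * (f (node x a δ 0) (u (node x a δ 0)) - f (node x a δ 0) (V 0))
            - (u a - u (node x a δ 0)
              - (a - node x a δ 0) * f (node x a δ 0) (u (node x a δ 0))) := by
        conv_lhs => rw [hV.zero]
        ring
      have h4 := abs_sub ((node x a δ 0 - a)
          * (f (node x a δ 0) (u (node x a δ 0)) - f (node x a δ 0) (V 0)))
        (u a - u (node x a δ 0) - (a - node x a δ 0) * f (node x a δ 0) (u (node x a δ 0)))
      rw [← h3] at h4
      linarith
  · rcases hV with hV | ⟨hV, hVR⟩
    · set s := node x a δ m.castSucc with hs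
      set t := node x a δ m.succ with ht
      have h1 := hdef' s (hn _) t (hn _) (hΔ m)
      have h2 := hmul (hΔ m) (hlip s (hn _) (u s) _ (by simpa using hR.le) hm)
      have h3 : u t - V m.succ = (u t - u s - (t - s) * f s (u s))
          + ((u s - V m.castSucc) + (t - s) * (f s (u s) - f s (V m.castSucc))) := by
        rw [hV.succ]
        ring
      have h4 := abs_add_le (u t - u s - (t - s) * f s (u s))
        ((u s - V m.castSucc) + (t - s) * (f s (u s) - f s (V m.castSucc)))
      have h5 := abs_add_le (u s - V m.castSucc) ((t - s) * (f s (u s) - f s (V m.castSucc)))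
      rw [← h3] at h4
      have h6 := abs_nonneg (u s - V m.castSucc)
      linarith
    · set s := node x a δ m.castSucc with hs
      set t := node x a δ m.succ with ht
      have h1 := hdef' t (hn _) s (hn _) (by rw [abs_sub_comm]; exact hΔ m)
      have h2 := hmul (hΔ m) (hlip t (hn _) (u t) _ (by simpa using hR.le) (hVR m.succ))
      have h3 : u t - V m.succ = ((u s - V m.castSucc) + (t - s) * (f t (u t) - f t (V m.succ)))
          - (u s - u t - (s - t) * f t (u t)) := by
        conv_lhs => rw [hV.succ]
        ring
      have h4 := abs_sub ((u s - V m.castSucc) + (t - s) * (f t (u t) - f t (V m.succ)))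
        (u s - u t - (s - t) * f t (u t))
      have h5 := abs_add_le (u s - V m.castSucc) ((t - s) * (f t (u t) - f t (V m.succ)))
      rw [← h3] at h4
      linarith

/-! ### Solvability and localization of the iterates -/

/-- Explicit steps stay near the exact solution. -/
theorem exists_explicitStep_nodalClose (hx : IsRightGaussRadau p x ω) {T : ℝ} {f : ℝ → ℝ → ℝ}
    (hf : Continuous (fun z : ℝ × ℝ => f z.1 z.2)) {u : ℝ → ℝ} (hu : ContDiff ℝ 1 u)
    {R : ℝ} (hR : 0 < R) :
    ∃ δ₀ : ℝ, 0 < δ₀ ∧ ∀ a δ : ℝ, 0 ≤ a → 0 < δ → δ ≤ δ₀ → a + δ ≤ T → ∀ U V,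
      NodalClose u x a δ R U → IsExplicitStep f x ω a δ (u a) U V → NodalClose u x a δ R V := by
  obtain ⟨F, hF, hbound⟩ := exists_tube_bound (T := T) hf hu.continuous R
  obtain ⟨L, hL, hinc⟩ := exists_increment_bound T hu
  have hB := collocBound_nonneg x
  set G : ℝ := 2 * F + 2 * collocBound x * F with hG
  have hG0 : 0 ≤ G := by positivity
  refine ⟨R / ((p + 1) * G + L + 1), by positivity, fun a δ ha hδ hδle haT U V hU hV => ?_⟩
  rw [le_div_iff₀ (by positivity)] at hδle
  have hn := node_mem_of_le hx ha hδ.le haT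
  have hun : ∀ i, |u (node x a δ i) - u a| ≤ L * δ := fun i => by
    obtain ⟨h1, h2⟩ := node_mem hx a hδ.le i
    refine (hinc a ⟨ha, by linarith⟩ _ (hn i)).trans (mul_le_mul_of_nonneg_left ?_ hL)
    rw [abs_le]
    constructor <;> linarith
  have hUF : ∀ j, |f (node x a δ j) (U j)| ≤ F := fun j => hbound _ (hn j) _ (hU j)
  have hsweep := abs_sweep_le hx hδ.le hF hUF
  -- Each node moves the value by at most `G δ`, from the sweep and the correction. Closeness at one
  -- node bounds `f` there, which is what the next node needs.
  have close : ∀ i : Fin (p + 1), |V i - u a| ≤ ((i : ℕ) + 1) * (G * δ) →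
      |u (node x a δ i) - V i| ≤ R := fun i hi => by
    have h1 : ((i : ℕ) : ℝ) ≤ p := by exact_mod_cast Nat.lt_succ_iff.1 i.2
    have h2 : ((i : ℕ) + 1) * (G * δ) ≤ (p + 1) * (G * δ) := by gcongr
    have h3 := hun i
    rw [abs_le] at hi h3 ⊢
    constructor <;> linarith [h3.1, h3.2, hi.1, hi.2]
  have key : ∀ i : Fin (p + 1), |V i - u a| ≤ ((i : ℕ) + 1) * (G * δ) := fun i => by
    induction i using Fin.induction with
    | zero =>
      have h1 := hsweep 0
      rw [hV.zero, add_sub_cancel_left]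
      simp only [Fin.val_zero, Nat.cast_zero, zero_add, one_mul, hG]
      nlinarith [mul_nonneg hF hδ.le]
    | succ m ih =>
      have h1 := hsweep m.succ
      have h2 : |f (node x a δ m.castSucc) (V m.castSucc) - f (node x a δ m.castSucc) (U m.castSucc)|
          ≤ 2 * F := by
        refine (abs_sub _ _).trans ?_
        linarith [hbound _ (hn m.castSucc) _ (close _ ih), hUF m.castSucc]
      have h3 := abs_half_mul_weight_mul_le hx hδ.le h2 m.castSucc
      simp only [Fin.val_castSucc] at ih
      rw [hV.succ]
      simp only [Fin.val_succ, hG] at ih ⊢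
      push_cast
      rw [abs_le] at h1 h3 ih ⊢
      constructor <;> linarith [h1.1, h1.2, h3.1, h3.2, ih.1, ih.2]
  exact fun i => close i (key i)

/-- A scalar implicit equation with a small Lipschitz constant has exactly one solution near `w`. -/
theorem existsUnique_implicit {φ : ℝ → ℝ} {c w R μ Λ F : ℝ} (hφ : Continuous φ)
    (hlip : ∀ y z, |w - y| ≤ R → |w - z| ≤ R → |φ y - φ z| ≤ Λ * |y - z|)
    (hbound : ∀ y, |w - y| ≤ R → |φ y| ≤ F) (hF : 0 ≤ F) (hμ : 0 ≤ μ)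
    (hμΛ : μ * Λ ≤ 1 / 2)
    (hR : |w - c| + μ * F ≤ R) : ∃! y, |w - y| ≤ R ∧ y = c + μ * φ y := by
  have hR0 : 0 ≤ R := (add_nonneg (abs_nonneg _) (mul_nonneg hμ hF)).trans hR
  have hwR : |w - (w - R)| ≤ R := by rw [sub_sub_cancel, abs_of_nonneg hR0]
  have hwR' : |w - (w + R)| ≤ R := by rw [sub_add_cancel_left, abs_neg, abs_of_nonneg hR0]
  have hcont : ContinuousOn (fun y => y - c - μ * φ y) (Set.Icc (w - R) (w + R)) :=
    ((continuous_id.sub continuous_const).sub (continuous_const.mul hφ)).continuousOn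
  have hμφ : ∀ y, |w - y| ≤ R → |μ * φ y| ≤ μ * F := fun y hy => by
    rw [abs_mul, abs_of_nonneg hμ]
    exact mul_le_mul_of_nonneg_left (hbound y hy) hμ
  -- Because `|w - c| + μ F ≤ R`, the function `y - c - μ φ y` is nonpositive at `w - R` and
  -- nonnegative at `w + R`.
  obtain ⟨y, hy, hy0⟩ := intermediate_value_Icc (by linarith) hcont (show (0 : ℝ) ∈ _ by
    have h1 := abs_le.1 (hμφ _ hwR)
    have h2 := abs_le.1 (hμφ _ hwR')
    have h3 := abs_le.1 (le_refl |w - c|)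
    constructor <;> linarith [h1.1, h1.2, h2.1, h2.2, h3.1, h3.2])
  refine ⟨y, ⟨?_, ?_⟩, fun z ⟨hz, hz'⟩ => ?_⟩
  · rw [abs_le]
    constructor <;> linarith [hy.1, hy.2]
  · simp only at hy0
    linarith
  · have hy1 : |w - y| ≤ R := by
      rw [abs_le]
      constructor <;> linarith [hy.1, hy.2]
    have h1 := hlip z y hz hy1
    have h2 : z - y = μ * (φ z - φ y) := by
      simp only at hy0
      linarith
    have h3 : |z - y| ≤ 1 / 2 * |z - y| := by
      calc |z - y| = μ * |φ z - φ y| := by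
            conv_lhs => rw [h2]
            rw [abs_mul, abs_of_nonneg hμ]
        _ ≤ μ * (Λ * |z - y|) := mul_le_mul_of_nonneg_left h1 hμ
        _ = μ * Λ * |z - y| := by ring
        _ ≤ 1 / 2 * |z - y| := mul_le_mul_of_nonneg_right hμΛ (abs_nonneg _)
    have h4 : |z - y| = 0 := by linarith [abs_nonneg (z - y)]
    exact sub_eq_zero.1 (abs_eq_zero.1 h4)

/-- Marching with scalar implicit equations has exactly one result near `w`. -/
theorem existsUnique_march {φ : Fin (p + 1) → ℝ → ℝ} {s μ w : Fin (p + 1) → ℝ} {v R Λ F κ : ℝ}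
    (hφ : ∀ i, Continuous (φ i))
    (hlip : ∀ i y z, |w i - y| ≤ R → |w i - z| ≤ R → |φ i y - φ i z| ≤ Λ * |y - z|)
    (hbound : ∀ i y, |w i - y| ≤ R → |φ i y| ≤ F) (hF : 0 ≤ F)
    (hμ : ∀ i, 0 ≤ μ i)
    (hμΛ : ∀ i, μ i * Λ ≤ 1 / 2) (hμF : ∀ i, μ i * F ≤ κ) (hs : ∀ i, |s i| ≤ κ)
    (hw : ∀ i, |w i - v| ≤ κ) (hκ : (2 * p + 3) * κ ≤ R) :
    ∃! V : Fin (p + 1) → ℝ,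
      (V 0 = v + s 0 + μ 0 * φ 0 (V 0) ∧
        ∀ m : Fin p, V m.succ = V m.castSucc + s m.succ + μ m.succ * φ m.succ (V m.succ)) ∧
      ∀ i, |w i - V i| ≤ R := by
  have hκ0 : 0 ≤ κ := (abs_nonneg _).trans (hs 0)
  -- Each node shifts the value by at most `2κ`, so the drift before any node is at most `2pκ`. The
  -- distance of `w` from `v`, the source `s` and the implicit term cost one `κ` each, which
  -- explains `(2p + 3) κ`.
  have sol : ∀ i c, |c - v| ≤ 2 * p * κ →
      ∃! y, |w i - y| ≤ R ∧ y = c + s i + μ i * φ i y := fun i c hc => by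
    refine existsUnique_implicit (hφ i) (hlip i) (hbound i) hF (hμ i) (hμΛ i) ?_
    have h1 : |w i - (c + s i)| ≤ |w i - v| + |c - v| + |s i| := by
      have e : w i - (c + s i) = (w i - v) - (c - v) - s i := by ring
      rw [e]
      exact (abs_sub _ _).trans (by linarith [abs_sub (w i - v) (c - v)])
    linarith [hw i, hs i, hμF i]
  have hinc : ∀ i c y, |w i - y| ≤ R → y = c + s i + μ i * φ i y →
      |y - v| ≤ |c - v| + 2 * κ := fun i c y hy hyc => by
    have h1 : |μ i * φ i y| ≤ κ := by
      rw [abs_mul, abs_of_nonneg (hμ i)]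
      exact (mul_le_mul_of_nonneg_left (hbound i y hy) (hμ i)).trans (hμF i)
    have h2 : y - v = (c - v) + s i + μ i * φ i y := by linarith
    rw [h2]
    refine (abs_add_le _ _).trans ?_
    linarith [abs_add_le (c - v) (s i), hs i]
  -- The solution map is made total, with the value `0` outside the admissible drift, so that it can
  -- be iterated by recursion.
  have hex : ∀ i c, ∃ y, |c - v| ≤ 2 * p * κ → |w i - y| ≤ R ∧ y = c + s i + μ i * φ i y :=
    fun i c => by
      by_cases hc : |c - v| ≤ 2 * p * κ
      · obtain ⟨y, hy, -⟩ := sol i c hc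
        exact ⟨y, fun _ => hy⟩
      · exact ⟨0, fun h => absurd h hc⟩
  choose G hG using hex
  have hv : |v - v| ≤ 2 * p * κ := by
    rw [sub_self, abs_zero]
    positivity
  have hcast : ∀ (m : Fin p) y, |y - v| ≤ 2 * (((m.castSucc : Fin (p + 1)) : ℕ) + 1) * κ →
      |y - v| ≤ 2 * p * κ := fun m y hy => by
    have h1 : (((m : ℕ) + 1 : ℕ) : ℝ) ≤ p := by exact_mod_cast m.2
    refine hy.trans (mul_le_mul_of_nonneg_right ?_ hκ0)
    simp only [Fin.val_castSucc]
    push_cast at h1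
    linarith
  set V : Fin (p + 1) → ℝ := fun i =>
    Fin.induction (motive := fun _ => ℝ) (G 0 v) (fun m y => G m.succ y) i with hV
  have hV0 : V 0 = G 0 v := rfl
  have hVs : ∀ m : Fin p, V m.succ = G m.succ (V m.castSucc) := fun m => by
    simp only [hV, Fin.induction_succ]
  have inv : ∀ i : Fin (p + 1), |V i - v| ≤ 2 * ((i : ℕ) + 1) * κ := fun i => by
    induction i using Fin.induction with
    | zero =>
      obtain ⟨h1, h2⟩ := hG 0 v hv
      have h3 := hinc 0 v _ h1 h2
      rw [hV0]
      simpa using h3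
    | succ m ih =>
      obtain ⟨h1, h2⟩ := hG m.succ _ (hcast m _ ih)
      have h3 := hinc m.succ _ _ h1 h2
      rw [hVs]
      refine h3.trans ((add_le_add_left ih _).trans (le_of_eq ?_))
      simp only [Fin.val_castSucc, Fin.val_succ]
      push_cast
      ring
  refine ⟨V, ⟨⟨?_, fun m => ?_⟩, fun i => ?_⟩, fun V' ⟨⟨h0, hsucc⟩, hR'⟩ => funext fun i => ?_⟩
  · rw [hV0]
    exact (hG 0 v hv).2
  · rw [hVs]
    exact (hG m.succ _ (hcast m _ (inv _))).2
  · refine Fin.cases ?_ (fun m => ?_) i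
    · rw [hV0]
      exact (hG 0 v hv).1
    · rw [hVs]
      exact (hG m.succ _ (hcast m _ (inv _))).1
  · induction i using Fin.induction with
    | zero =>
      rw [hV0]
      exact (sol 0 v hv).unique ⟨hR' 0, h0⟩ (hG 0 v hv)
    | succ m ih =>
      rw [hVs]
      have hc := hcast m _ (inv m.castSucc)
      refine (sol m.succ _ hc).unique ⟨hR' m.succ, ?_⟩ (hG m.succ _ hc)
      rw [← ih]
      exact hsucc m

theorem existsUnique_iteration {α : Type*} {K : ℕ} {P : α → Prop} {r : α → α → Prop}
    (h : ∀ a, P a → ∃! b, P b ∧ r a b) {a₀ : α} (ha₀ : P a₀) :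
    ∃! U : Fin (K + 1) → α, (U 0 = a₀ ∧ ∀ k : Fin K, r (U k.castSucc) (U k.succ)) ∧
      ∀ k, P (U k) := by
  have hex : ∀ a, ∃ b, P a → P b ∧ r a b := fun a => by
    by_cases ha : P a
    · obtain ⟨b, hb, -⟩ := h a ha
      exact ⟨b, fun _ => hb⟩
    · exact ⟨a, fun h => absurd h ha⟩
  choose G hG using hex
  set U : Fin (K + 1) → α := fun k =>
    Fin.induction (motive := fun _ => α) a₀ (fun _ a => G a) k with hU
  have hUs : ∀ k : Fin K, U k.succ = G (U k.castSucc) := fun k => by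
    simp only [hU, Fin.induction_succ]
  have hP : ∀ k, P (U k) := fun k => by
    induction k using Fin.induction with
    | zero => exact ha₀
    | succ k ih =>
      rw [hUs]
      exact (hG _ ih).1
  refine ⟨U, ⟨⟨rfl, fun k => ?_⟩, hP⟩, fun U' ⟨⟨h0, hs⟩, hP'⟩ => funext fun k => ?_⟩
  · rw [hUs]
    exact (hG _ (hP _)).2
  · induction k using Fin.induction with
    | zero => exact h0
    | succ k ih =>
      rw [hUs]
      refine (h _ (hP k.castSucc)).unique ⟨hP' k.succ, ?_⟩ (hG _ (hP _))
      rw [← ih]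
      exact hs k

/-- The implicit equations are uniquely solvable near the exact solution. -/
theorem exists_implicit_existsUnique (hx : IsRightGaussRadau p x ω) {T : ℝ} {f : ℝ → ℝ → ℝ}
    (hf : ContDiff ℝ 1 (fun z : ℝ × ℝ => f z.1 z.2)) {u : ℝ → ℝ} (hu : ContDiff ℝ 1 u)
    {R : ℝ} (hR : 0 < R) :
    ∃ δ₀ : ℝ, 0 < δ₀ ∧ ∀ a δ : ℝ, 0 ≤ a → 0 < δ → δ ≤ δ₀ → a + δ ≤ T →
      (∃! V, IsImplicitEuler f x a δ (u a) V ∧ NodalClose u x a δ R V) ∧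
      ∀ U, NodalClose u x a δ R U →
        ∃! V, NodalClose u x a δ R V ∧ IsImplicitStep f x ω a δ (u a) U V := by
  obtain ⟨Λ, hΛ, hlip⟩ := exists_tube_lipschitz (T := T) hf hu.continuous R
  obtain ⟨F, hF, hbound⟩ := exists_tube_bound (T := T) hf.continuous hu.continuous R
  obtain ⟨L, hL, hinc⟩ := exists_increment_bound T hu
  have hB := collocBound_nonneg x
  -- Collects the sweep (`2 * collocBound x * F`), the correction (`F`) and the growth of `u` over
  -- the interval (`L`).
  set G : ℝ := (2 * collocBound x + 1) * F + L with hG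
  have hG0 : 0 ≤ G := by positivity
  refine ⟨min (1 / (2 * (Λ + 1))) (R / ((2 * p + 3) * G + 1)), by positivity,
    fun a δ ha hδ hδle haT => ?_⟩
  have hδΛ : δ ≤ 1 / (2 * (Λ + 1)) := hδle.trans (min_le_left _ _)
  have hδR : δ ≤ R / ((2 * p + 3) * G + 1) := hδle.trans (min_le_right _ _)
  rw [le_div_iff₀ (by positivity)] at hδΛ hδR
  have hn := node_mem_of_le hx ha hδ.le haT
  have hκ : (2 * p + 3) * (G * δ) ≤ R := by nlinarith
  have hFδ : δ * F ≤ G * δ := by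
    have h1 : 0 ≤ 2 * collocBound x * F * δ := by positivity
    have h2 : 0 ≤ L * δ := by positivity
    rw [hG]
    nlinarith
  have hw : ∀ i, |u (node x a δ i) - u a| ≤ G * δ := fun i => by
    obtain ⟨h1, h2⟩ := node_mem hx a hδ.le i
    have h3 : |node x a δ i - a| ≤ δ := by
      rw [abs_le]
      constructor <;> linarith
    have h4 : L * |node x a δ i - a| ≤ L * δ := mul_le_mul_of_nonneg_left h3 hL
    have h5 : 0 ≤ (2 * collocBound x + 1) * F * δ := by positivity
    have h6 := hinc a ⟨ha, by linarith⟩ _ (hn i)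
    rw [hG]
    linarith
  have hφ : ∀ i, Continuous (f (node x a δ i)) := fun i =>
    hf.continuous.comp (continuous_const.prodMk continuous_id)
  have march : ∀ s μ : Fin (p + 1) → ℝ, (∀ i, μ i ∈ Set.Icc 0 δ) → (∀ i, |s i| ≤ G * δ) → _ :=
    fun s μ hμ hs => existsUnique_march (φ := fun i => f (node x a δ i)) (s := s) (μ := μ)
      (w := fun i => u (node x a δ i)) (v := u a) (R := R) (Λ := Λ) (F := F) (κ := G * δ) hφ
      (fun i => hlip _ (hn i)) (fun i => hbound _ (hn i)) hF (fun i => (hμ i).1)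
      (fun i => by
        have : μ i * Λ ≤ δ * Λ := mul_le_mul_of_nonneg_right (hμ i).2 hΛ
        nlinarith)
      (fun i => (mul_le_mul_of_nonneg_right (hμ i).2 hF).trans hFδ) hs hw hκ
  constructor
  · have h := march 0 (Fin.cases (node x a δ 0 - a)
      fun m => node x a δ m.succ - node x a δ m.castSucc)
      (fun i => by
        refine Fin.cases ?_ (fun m => ?_) i
        · obtain ⟨h1, h2⟩ := node_mem hx a hδ.le 0
          constructor <;> simp only [Fin.cases_zero] <;> linarith
        · simpa using node_sub_mem hx a hδ.le m)
      (fun i => by simpa using by positivity)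
    refine (existsUnique_congr fun V => and_congr_left fun _ => ?_).1 h
    simp only [Pi.zero_apply, add_zero, Fin.cases_zero, Fin.cases_succ]
    exact ⟨fun ⟨h1, h2⟩ => ⟨h1, h2⟩, fun h => ⟨h.zero, h.succ⟩⟩
  · intro U hU
    have hUF : ∀ j, |f (node x a δ j) (U j)| ≤ F := fun j => hbound _ (hn j) _ (hU j)
    -- All terms in the old iterate go into the source `s`; the coefficient of the implicit term is
    -- `δ ω i / 2`, at most `δ`.
    have h := march
      (fun i => sweep f x ω a δ U i - δ / 2 * ω i * f (node x a δ i) (U i))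
      (fun i => δ / 2 * ω i)
      (fun i => by
        have h1 := hx.weight_le_two i
        have h2 := hx.weight_nonneg i
        constructor <;> nlinarith)
      (fun i => by
        have h1 := abs_sweep_le hx hδ.le hF hUF i
        have h2 := abs_half_mul_weight_mul_le hx hδ.le (hUF i) i
        have h3 : 0 ≤ L * δ := by positivity
        refine (abs_sub _ _).trans ?_
        rw [hG]
        linarith)
    refine (existsUnique_congr fun V => ?_).1 h
    rw [and_comm]
    refine and_congr_right fun _ => ⟨fun ⟨h1, h2⟩ => ⟨?_, fun m => ?_⟩, fun h => ⟨?_, fun m => ?_⟩⟩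
    · linarith
    · linarith [h2 m]
    · linarith [h.zero]
    · linarith [h.succ m]

/-! ### The local truncation error -/

theorem nodalClose_mono {u : ℝ → ℝ} {a δ r s : ℝ} {V : Fin (p + 1) → ℝ} (hrs : r ≤ s)
    (hV : NodalClose u x a δ r V) : NodalClose u x a δ s V := fun m => (hV m).trans hrs

/-- Explicit iterates need no localization hypothesis: the tube of radius `1` is an arbitrary
choice, and for small `h` the start and then every iterate lie in it. -/
theorem exists_explicit_error_bounds (hx : IsRightGaussRadau p x ω) {T : ℝ} {f : ℝ → ℝ → ℝ}
    (hf : ContDiff ℝ (2 * p + 1 : ℕ) (fun z : ℝ × ℝ => f z.1 z.2)) {u : ℝ → ℝ}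
    (hu : ContDiff ℝ (2 * p + 2 : ℕ) u)
    (hu' : ∀ s ∈ Set.Icc 0 T, HasDerivAt u (f s (u s)) s) (K : ℕ) (C₀ : ℝ) :
    ∃ C h₀ : ℝ, 0 < h₀ ∧ ∀ a δ h : ℝ, 0 ≤ a → 0 < δ → δ ≤ h → h ≤ h₀ → a + δ ≤ T → ∀ V,
      (IsExplicitEuler f x a δ (u a) V ∨ NodalClose u x a δ (C₀ * h ^ 2) V) →
      ∀ U : Fin (K + 1) → Fin (p + 1) → ℝ, IsExplicitIteration f x ω a δ (u a) V U →
        ErrorBounds K u x a δ C h (U (Fin.last K)) := by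
  have hf1 : ContDiff ℝ 1 (fun z : ℝ × ℝ => f z.1 z.2) :=
    hf.of_le (by exact_mod_cast (by omega))
  have hu1 : ContDiff ℝ 1 u := hu.of_le (by exact_mod_cast (by omega))
  have hu2 : ContDiff ℝ 2 u := hu.of_le (by exact_mod_cast (by omega))
  obtain ⟨C₁, δ₁, hC₁, hδ₁, hE⟩ := exists_euler_error_bound hx hf1 hu2 hu' one_pos
  obtain ⟨δ₂, hδ₂, hS⟩ := exists_explicitStep_nodalClose hx (T := T) hf1.continuous hu1 one_pos
  -- One constant for both kinds of start, nonnegative even if `C₀` is negative.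
  set C₂ : ℝ := max C₁ C₀ with hC₂
  have hC₂0 : 0 ≤ C₂ := hC₁.trans (le_max_left _ _)
  obtain ⟨C, h₀, hh₀, hI⟩ := exists_iteration_error_bounds hx hf hu hu' zero_le_one hC₂0 K
  refine ⟨C, min (min h₀ (min δ₁ δ₂)) (1 / (C₂ + 1)), by positivity,
    fun a δ h ha hδ hδh hh haT V hV U hU => ?_⟩
  obtain ⟨⟨h1, h2, h3⟩, h4⟩ : (h ≤ h₀ ∧ h ≤ δ₁ ∧ h ≤ δ₂) ∧ h ≤ 1 / (C₂ + 1) := by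
    simpa only [le_min_iff] using hh
  have hh0 : 0 < h := hδ.trans_le hδh
  have hV' : NodalClose u x a δ (C₂ * h ^ 2) V := by
    rcases hV with hV | hV
    · refine nodalClose_mono ?_ (hE a δ ha hδ (hδh.trans h2) haT V (Or.inl hV))
      exact mul_le_mul (le_max_left _ _) (pow_le_pow_left₀ hδ.le hδh 2) (by positivity) hC₂0
    · exact nodalClose_mono (mul_le_mul_of_nonneg_right (le_max_right _ _) (by positivity)) hV
  have hsmall : C₂ * h ^ 2 ≤ 1 := by
    rw [le_div_iff₀ (by positivity)] at h4
    have h5 : h ≤ 1 := by nlinarith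
    nlinarith
  have hU0 : NodalClose u x a δ (C₂ * h ^ 2) (U 0) := by rwa [hU.1]
  refine hI a δ h ha hδ hδh h1 haT U (fun k => ?_) hU0 (fun k => Or.inl (hU.2 k))
  induction k using Fin.induction with
  | zero => exact nodalClose_mono hsmall hU0
  | succ k ih => exact hS a δ ha hδ (hδh.trans h3) haT _ _ ih (hU.2 k)

theorem exists_implicit_error_bounds (hx : IsRightGaussRadau p x ω) {T : ℝ} {f : ℝ → ℝ → ℝ}
    (hf : ContDiff ℝ (2 * p + 1 : ℕ) (fun z : ℝ × ℝ => f z.1 z.2)) {u : ℝ → ℝ}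
    (hu : ContDiff ℝ (2 * p + 2 : ℕ) u)
    (hu' : ∀ s ∈ Set.Icc 0 T, HasDerivAt u (f s (u s)) s) (K : ℕ) (C₀ : ℝ) {R : ℝ} (hR : 0 < R) :
    ∃ C h₀ : ℝ, 0 < h₀ ∧ ∀ a δ h : ℝ, 0 ≤ a → 0 < δ → δ ≤ h → h ≤ h₀ → a + δ ≤ T →
      (∃! V, IsImplicitEuler f x a δ (u a) V ∧ NodalClose u x a δ R V) ∧
      ∀ V, ((IsImplicitEuler f x a δ (u a) V ∧ NodalClose u x a δ R V) ∨
          NodalClose u x a δ (C₀ * h ^ 2) V) →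
        (∃! U : Fin (K + 1) → Fin (p + 1) → ℝ, IsImplicitIteration f x ω a δ (u a) V U ∧
          ∀ k, NodalClose u x a δ R (U k)) ∧
        ∀ U : Fin (K + 1) → Fin (p + 1) → ℝ, IsImplicitIteration f x ω a δ (u a) V U →
          (∀ k, NodalClose u x a δ R (U k)) → ErrorBounds K u x a δ C h (U (Fin.last K)) := by
  have hf1 : ContDiff ℝ 1 (fun z : ℝ × ℝ => f z.1 z.2) :=
    hf.of_le (by exact_mod_cast (by omega))
  have hu1 : ContDiff ℝ 1 u := hu.of_le (by exact_mod_cast (by omega))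
  have hu2 : ContDiff ℝ 2 u := hu.of_le (by exact_mod_cast (by omega))
  obtain ⟨C₁, δ₁, hC₁, hδ₁, hE⟩ := exists_euler_error_bound hx hf1 hu2 hu' hR
  obtain ⟨δ₂, hδ₂, hS⟩ := exists_implicit_existsUnique hx (T := T) hf1 hu1 hR
  set C₂ : ℝ := max C₁ C₀ with hC₂
  have hC₂0 : 0 ≤ C₂ := hC₁.trans (le_max_left _ _)
  obtain ⟨C, h₀, hh₀, hI⟩ := exists_iteration_error_bounds hx hf hu hu' hR.le hC₂0 K
  refine ⟨C, min (min h₀ (min δ₁ δ₂)) (min 1 (R / (C₂ + 1))), by positivity,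
    fun a δ h ha hδ hδh hh haT => ?_⟩
  obtain ⟨⟨h1, h2, h3⟩, h4, h5⟩ :
      (h ≤ h₀ ∧ h ≤ δ₁ ∧ h ≤ δ₂) ∧ h ≤ 1 ∧ h ≤ R / (C₂ + 1) := by
    simpa only [le_min_iff] using hh
  have hh0 : 0 < h := hδ.trans_le hδh
  obtain ⟨hEuler, hStep⟩ := hS a δ ha hδ (hδh.trans h3) haT
  refine ⟨hEuler, fun V hV => ?_⟩
  have hV' : NodalClose u x a δ (C₂ * h ^ 2) V := by
    rcases hV with hV | hV
    · refine nodalClose_mono ?_ (hE a δ ha hδ (hδh.trans h2) haT V (Or.inr hV))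
      exact mul_le_mul (le_max_left _ _) (pow_le_pow_left₀ hδ.le hδh 2) (by positivity) hC₂0
    · exact nodalClose_mono (mul_le_mul_of_nonneg_right (le_max_right _ _) (by positivity)) hV
  have hsmall : C₂ * h ^ 2 ≤ R := by
    rw [le_div_iff₀ (by positivity)] at h5
    have h6 : C₂ * h ^ 2 ≤ C₂ * h := mul_le_mul_of_nonneg_left (by nlinarith) hC₂0
    nlinarith
  refine ⟨existsUnique_iteration hStep (nodalClose_mono hsmall hV'), fun U hU hUR => ?_⟩
  exact hI a δ h ha hδ hδh h1 haT U hUR (by rwa [hU.1]) (fun k => Or.inr (hU.2 k))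

theorem IsPartition.stepSize_spec {N : ℕ} {T : ℝ} {t : Fin (N + 1) → ℝ} (ht : IsPartition T t)
    (n : Fin N) : 0 ≤ t n.castSucc ∧ 0 < stepSize t n ∧ stepSize t n ≤ mesh t ∧
      t n.castSucc + stepSize t n ≤ T := by
  refine ⟨?_, ?_, le_ciSup (Set.finite_range fun n => stepSize t n).bddAbove n, ?_⟩
  · rw [← ht.zero_eq]
    exact ht.strictMono.monotone (Fin.zero_le _)
  · exact sub_pos.2 (ht.strictMono Fin.castSucc_lt_succ)
  · rw [stepSize, add_sub_cancel, ← ht.last_eq]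
    exact ht.strictMono.monotone (Fin.le_last _)

theorem nodalClose_congr {u w : ℝ → ℝ} {a δ : ℝ}
    (h : ∀ m, w (node x a δ m) = u (node x a δ m)) (r : ℝ) (V : Fin (p + 1) → ℝ) :
    NodalClose u x a δ r V ↔ NodalClose w x a δ r V := by
  simp only [NodalClose, h]

theorem errorBounds_congr {u w : ℝ → ℝ} {a δ : ℝ}
    (h : ∀ m, w (node x a δ m) = u (node x a δ m)) (h' : w (a + δ) = u (a + δ)) (K : ℕ) (C r : ℝ)
    (V : Fin (p + 1) → ℝ) : ErrorBounds K u x a δ C r V ↔ ErrorBounds K w x a δ C r V := by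
  simp only [ErrorBounds, h, h']

end SDG

end

theorem mainTheorem2 (p K : ℕ) (x ω : Fin (p + 1) → ℝ) (hx : SDG.IsRightGaussRadau p x ω)
    (T : ℝ) (hT : 0 < T) (f : ℝ → ℝ → ℝ)
    (hf : ContDiff ℝ ((2 * p + 1 : ℕ) : WithTop ℕ∞) (fun z : ℝ × ℝ => f z.1 z.2))
    (u₀ : ℝ) (u : ℝ → ℝ) (hu₀ : u 0 = u₀)
    (hu : ∀ s ∈ Set.Icc 0 T, HasDerivWithinAt u (f s (u s)) (Set.Icc 0 T) s) :
    -- the explicit scheme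
    (∀ C₀ : ℝ, ∃ C h₀ : ℝ, 0 < h₀ ∧
      ∀ (N : ℕ) (t : Fin (N + 1) → ℝ), SDG.IsPartition T t → SDG.mesh t ≤ h₀ →
      ∀ (n : Fin N) (V : Fin (p + 1) → ℝ),
        (SDG.IsExplicitEuler f x (t n.castSucc) (SDG.stepSize t n) (u (t n.castSucc)) V ∨
          SDG.NodalClose u x (t n.castSucc) (SDG.stepSize t n) (C₀ * SDG.mesh t ^ 2) V) →
        ∀ U : Fin (K + 1) → Fin (p + 1) → ℝ,
          SDG.IsExplicitIteration f x ω (t n.castSucc) (SDG.stepSize t n) (u (t n.castSucc)) V U →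
          SDG.ErrorBounds K u x (t n.castSucc) (SDG.stepSize t n) C (SDG.mesh t)
            (U (Fin.last K))) ∧
    -- the implicit scheme, with the solutions of its equations taken near the exact solution
    (∀ C₀ R : ℝ, 0 < R → ∃ C h₀ : ℝ, 0 < h₀ ∧
      ∀ (N : ℕ) (t : Fin (N + 1) → ℝ), SDG.IsPartition T t → SDG.mesh t ≤ h₀ →
      ∀ n : Fin N,
        (∃! V : Fin (p + 1) → ℝ,
          SDG.IsImplicitEuler f x (t n.castSucc) (SDG.stepSize t n) (u (t n.castSucc)) V ∧
          SDG.NodalClose u x (t n.castSucc) (SDG.stepSize t n) R V) ∧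
        ∀ V : Fin (p + 1) → ℝ,
          ((SDG.IsImplicitEuler f x (t n.castSucc) (SDG.stepSize t n) (u (t n.castSucc)) V ∧
              SDG.NodalClose u x (t n.castSucc) (SDG.stepSize t n) R V) ∨
            SDG.NodalClose u x (t n.castSucc) (SDG.stepSize t n) (C₀ * SDG.mesh t ^ 2) V) →
          (∃! U : Fin (K + 1) → Fin (p + 1) → ℝ,
            SDG.IsImplicitIteration f x ω (t n.castSucc) (SDG.stepSize t n)
              (u (t n.castSucc)) V U ∧
            ∀ k, SDG.NodalClose u x (t n.castSucc) (SDG.stepSize t n) R (U k)) ∧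
          ∀ U : Fin (K + 1) → Fin (p + 1) → ℝ,
            SDG.IsImplicitIteration f x ω (t n.castSucc) (SDG.stepSize t n)
              (u (t n.castSucc)) V U →
            (∀ k, SDG.NodalClose u x (t n.castSucc) (SDG.stepSize t n) R (U k)) →
            SDG.ErrorBounds K u x (t n.castSucc) (SDG.stepSize t n) C (SDG.mesh t)
              (U (Fin.last K))) := by
  -- The claims involve `u` only at points of `[0, T]`, so the globally smooth extension `w` may
  -- take its place.
  obtain ⟨w, hw, hwu, hw'⟩ := SDG.exists_contDiff_extension hT hf hu
  have congr : ∀ {N : ℕ} {t : Fin (N + 1) → ℝ}, SDG.IsPartition T t → ∀ n : Fin N,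
      w (t n.castSucc) = u (t n.castSucc) ∧
      (∀ m, w (SDG.node x (t n.castSucc) (SDG.stepSize t n) m)
        = u (SDG.node x (t n.castSucc) (SDG.stepSize t n) m)) ∧
      w (t n.castSucc + SDG.stepSize t n) = u (t n.castSucc + SDG.stepSize t n) := by
    intro N t ht n
    obtain ⟨ha, hδ, -, haT⟩ := ht.stepSize_spec n
    exact ⟨hwu _ ⟨ha, by linarith⟩, fun m => hwu _ (SDG.node_mem_of_le hx ha hδ.le haT m),
      hwu _ ⟨by linarith, haT⟩⟩
  constructor
  · intro C₀
    obtain ⟨C, h₀, hh₀, H⟩ := SDG.exists_explicit_error_bounds hx hf hw hw' K C₀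
    refine ⟨C, h₀, hh₀, fun N t ht hmesh n => ?_⟩
    obtain ⟨h1, h2, h3⟩ := congr ht n
    obtain ⟨ha, hδ, hδh, haT⟩ := ht.stepSize_spec n
    simp only [SDG.nodalClose_congr h2, SDG.errorBounds_congr h2 h3, ← h1]
    exact H _ _ _ ha hδ hδh hmesh haT
  · intro C₀ R hR
    obtain ⟨C, h₀, hh₀, H⟩ := SDG.exists_implicit_error_bounds hx hf hw hw' K C₀ hR
    refine ⟨C, h₀, hh₀, fun N t ht hmesh n => ?_⟩
    obtain ⟨h1, h2, h3⟩ := congr ht n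
    obtain ⟨ha, hδ, hδh, haT⟩ := ht.stepSize_spec n
    simp only [SDG.nodalClose_congr h2, SDG.errorBounds_congr h2 h3, ← h1]
    exact H _ _ _ ha hδ hδh hmesh haT
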